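/- Let $K>0$. Let $\bar p_\xi$ be the closure in $L^2(\mathbb R,\mathbb C)$ of the essentially self-adjoint operator $C_0^\infty(\mathbb R,\mathbb C)\to L^2(\mathbb R,\mathbb C)$, $h\mapsto \frac{i}{K}h'$; it is self-adjoint, so that it has a unique spectral measure, and for a bounded Borel function $g:\mathbb R\to\mathbb C$ let $g(\bar p_\xi)$ be the bounded operator given by the functional calculus of $\bar p_\xi$. Let $B^{1/2}$ and $B^{-1/2}$ be the maximal multiplication operators in $L^2(\mathbb R,\mathbb C)$ by the functions $\xi\mapsto e^{-K\xi}$ and $\xi\mapsto e^{K\xi}$, respectively. Identify $\mathbb R\times[-1,0]$ with the strip $\{z\in\mathbb C:-1\le \operatorname{Im}z\le 0\}$ and let $\mathcal A$ be the set of all functions $f:\mathbb R\times[-1,0]\to\mathbb C$ such that 1. $f(\cdot,0)$ and $f(\cdot,-1)$ are bounded and strongly (Borel) measurable on $\mathbb R$; 2. $\lim_{y\to 0-}f(\cdot,y)=f(\cdot,0)$ and $\lim_{y\to(-1)+}f(\cdot,y)=f(\cdot,-1)$ almost everywhere on $\mathbb R$; 3. $f$ is holomorphic on $\mathbb R\times(-1,0)$,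 and there are $C\ge 0$ and $N\in\mathbb N$ with $|f(z)|\le C(1+|z|)^N$ for every $z\in\mathbb R\times[-1,0]$. Then for every $f\in\mathcal A$, with $f(\bar p_\xi,y):=(f(\cdot,y))(\bar p_\xi)$ for $y\in\{0,-1\}$, and with $B^{-1/2}f(\bar p_\xi,0)B^{1/2}$ defined on its natural domain $D\big(B^{-1/2}f(\bar p_\xi,0)B^{1/2}\big)=\{u\in D(B^{1/2}): f(\bar p_\xi,0)B^{1/2}u\in D(B^{-1/2})\}$, $$C_0^\infty(\mathbb R,\mathbb C)\subset D\big(B^{-1/2}f(\bar p_\xi,0)B^{1/2}\big),$$ and the operator $B^{-1/2}f(\bar p_\xi,0)B^{1/2}$ is closable, with closure the bounded, everywhere defined operator $$\overline{B^{-1/2}f(\bar p_\xi,0)B^{1/2}}=f(\bar p_\xi,-1).$$ -/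

import Mathlib

open MeasureTheory Filter Topology
open scoped ENNReal ContDiff InnerProductSpace

noncomputable section

/-! ### Projection-valued measures and the functional calculus of a self-adjoint operator -/

/-- A (normalised) projection-valued measure on the Borel sets of `ℝ`: orthogonal projections
`proj s`, countably additive in the strong operator topology, with `proj ℝ = 1`. The value on
non-measurable sets carries no information and is set to `0`. -/
@[ext] structure ProjValuedMeasure (H : Type*) [NormedAddCommGroup H] [InnerProductSpace ℂ H]
    [CompleteSpace H] where
  proj : Set ℝ → (H →L[ℂ] H)
  isStarProjection : ∀ s, MeasurableSet s → IsStarProjection (proj s)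
  not_measurable : ∀ s, ¬ MeasurableSet s → proj s = 0
  proj_univ : proj Set.univ = 1
  hasSum_iUnion : ∀ s : ℕ → Set ℝ, (∀ i, MeasurableSet (s i)) →
    (∀ i j, i ≠ j → Disjoint (s i) (s j)) →
    ∀ x : H, HasSum (fun i => proj (s i) x) (proj (⋃ i, s i) x)

namespace ProjValuedMeasure

variable {H : Type*} [NormedAddCommGroup H] [InnerProductSpace ℂ H] [CompleteSpace H]

theorem inner_proj (E : ProjValuedMeasure H) {s : Set ℝ} (hs : MeasurableSet s) (x : H) :
    ⟪x, E.proj s x⟫_ℂ = ((‖E.proj s x‖ ^ 2 : ℝ) : ℂ) := by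
  have h := E.isStarProjection s hs
  have h1 : E.proj s (E.proj s x) = E.proj s x :=
    congrArg (fun T : H →L[ℂ] H => T x) h.isIdempotentElem
  have h2 : ContinuousLinearMap.adjoint (E.proj s) = E.proj s := h.isSelfAdjoint
  rw [← h1, ← ContinuousLinearMap.adjoint_inner_left, h2, h1, inner_self_eq_norm_sq_to_K]
  push_cast
  rfl

theorem proj_empty (E : ProjValuedMeasure H) : E.proj ∅ = 0 := by
  ext x
  have h := E.hasSum_iUnion (fun _ => ∅) (fun _ => MeasurableSet.empty)
    (fun _ _ _ => disjoint_bot_left) x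
  have h2 := h.summable.tendsto_atTop_zero
  simpa using tendsto_nhds_unique tendsto_const_nhds h2

/-- The spectral measure of a vector, `μ_x(s) = ⟪x, E(s) x⟫ = ‖E(s) x‖²`. -/
def vectorMeasure (E : ProjValuedMeasure H) (x : H) : Measure ℝ :=
  Measure.ofMeasurable (fun s _ => ENNReal.ofReal (‖E.proj s x‖ ^ 2))
    (by simp [E.proj_empty])
    (by
      intro s hs hd
      have h := E.hasSum_iUnion s hs (fun i j hij => hd hij) x
      have h1 := (h.mapL (innerSL ℂ x))
      simp only [innerSL_apply_apply, E.inner_proj (hs _),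
        E.inner_proj (MeasurableSet.iUnion hs)] at h1
      have h2 := Complex.hasSum_ofReal.mp h1
      rw [← h2.tsum_eq]
      exact ENNReal.ofReal_tsum_of_nonneg (fun _ => sq_nonneg _) h2.summable)

theorem vectorMeasure_apply (E : ProjValuedMeasure H) (x : H) {s : Set ℝ}
    (hs : MeasurableSet s) : E.vectorMeasure x s = ENNReal.ofReal (‖E.proj s x‖ ^ 2) :=
  Measure.ofMeasurable_apply s hs

theorem vectorMeasure_univ (E : ProjValuedMeasure H) (x : H) :
    E.vectorMeasure x Set.univ = ENNReal.ofReal (‖x‖ ^ 2) := by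
  rw [E.vectorMeasure_apply x MeasurableSet.univ, E.proj_univ]
  rfl

instance (E : ProjValuedMeasure H) (x : H) : IsFiniteMeasure (E.vectorMeasure x) :=
  ⟨by rw [E.vectorMeasure_univ]; exact ENNReal.ofReal_lt_top⟩

theorem vectorMeasure_real (E : ProjValuedMeasure H) (x : H) {s : Set ℝ}
    (hs : MeasurableSet s) : (E.vectorMeasure x).real s = ‖E.proj s x‖ ^ 2 := by
  rw [measureReal_def, E.vectorMeasure_apply x hs, ENNReal.toReal_ofReal (sq_nonneg _)]

/-- `E` is the spectral measure of the (unbounded) operator `T`, i.e. `T = ∫ t dE(t)`: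
the domain of `T` consists of the `x` with `∫ t² dμ_x(t) < ∞`, and `⟪x, T x⟫ = ∫ t dμ_x(t)`
for these `x`. -/
def IsSpectralMeasureOf (E : ProjValuedMeasure H) (T : H →ₗ.[ℂ] H) : Prop :=
  (∀ x : H, x ∈ T.domain ↔ ∫⁻ t, ENNReal.ofReal (t ^ 2) ∂(E.vectorMeasure x) < ⊤) ∧
  ∀ x : T.domain, ⟪(x : H), T x⟫_ℂ = ∫ t, (t : ℂ) ∂(E.vectorMeasure (x : H))

open scoped Classical in
/-- The operator `∫ g dE` for a bounded Borel function `g`: the unique bounded operator `S` with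
`⟪x, S x⟫ = ∫ g dμ_x` for all `x` (existence and uniqueness are proved below). -/
def integral (E : ProjValuedMeasure H) (g : ℝ → ℂ) : H →L[ℂ] H :=
  if h : ∃ S : H →L[ℂ] H, ∀ x : H, ⟪x, S x⟫_ℂ = ∫ t, g t ∂(E.vectorMeasure x)
  then h.choose else 0

theorem exists_integral_simple (E : ProjValuedMeasure H) (g : SimpleFunc ℝ ℂ) :
    ∃ S : H →L[ℂ] H, ∀ x : H, ⟪x, S x⟫_ℂ = ∫ t, g t ∂(E.vectorMeasure x) := by
  induction g using SimpleFunc.induction with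
  | const c hs =>
    rename_i s
    refine ⟨c • E.proj s, fun x => ?_⟩
    have h : ∫ t, s.indicator (fun _ => c) t ∂(E.vectorMeasure x) =
        ((‖E.proj s x‖ ^ 2 : ℝ) : ℂ) * c := by
      rw [integral_indicator_const c hs, E.vectorMeasure_real x hs, Complex.real_smul]
    simp only [SimpleFunc.coe_piecewise, SimpleFunc.coe_const, Function.const_zero,
      Set.piecewise_eq_indicator]
    rw [show (Function.const ℝ c) = fun _ => c from rfl, h,
      _root_.smul_apply, inner_smul_right, E.inner_proj hs, mul_comm]
  | add _ h1 h2 =>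
    rename_i f g _
    obtain ⟨S, hS⟩ := h1
    obtain ⟨T, hT⟩ := h2
    refine ⟨S + T, fun x => ?_⟩
    rw [_root_.add_apply, inner_add_right, hS, hT, SimpleFunc.coe_add]
    exact (integral_add (SimpleFunc.integrable_of_isFiniteMeasure f)
      (SimpleFunc.integrable_of_isFiniteMeasure g)).symm

theorem polarize (S : H →L[ℂ] H) (x y : H) :
    ⟪x, S y⟫_ℂ = (⟪x + y, S (x + y)⟫_ℂ - ⟪x - y, S (x - y)⟫_ℂ
      - Complex.I * ⟪x + Complex.I • y, S (x + Complex.I • y)⟫_ℂ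
      + Complex.I * ⟪x - Complex.I • y, S (x - Complex.I • y)⟫_ℂ) / 4 := by
  simp only [map_add, map_sub, map_smul, inner_add_left, inner_add_right, inner_sub_left,
    inner_sub_right, inner_smul_left, inner_smul_right, Complex.conj_I]
  ring_nf
  simp only [Complex.I_sq]
  ring

theorem bound_of_scaling {B : H → H → ℂ} {M : ℝ}
    (h1 : ∀ (c : ℝ) x y, B (c • x) y = c * B x y)
    (h2 : ∀ (c : ℝ) x y, B x (c • y) = c * B x y)
    (hB : ∀ x y, ‖B x y‖ ≤ M * (‖x‖ ^ 2 + ‖y‖ ^ 2)) (x y : H) :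
    ‖B x y‖ ≤ 2 * M * ‖x‖ * ‖y‖ := by
  by_cases hx : x = 0
  · subst hx
    simpa using (congrArg norm (h1 0 0 y)).le
  by_cases hy : y = 0
  · subst hy
    simpa using (congrArg norm (h2 0 x 0)).le
  have hx' : 0 < ‖x‖ := norm_pos_iff.mpr hx
  have hy' : 0 < ‖y‖ := norm_pos_iff.mpr hy
  have h := hB (‖x‖⁻¹ • x) (‖y‖⁻¹ • y)
  rw [h1, h2, norm_mul, norm_mul, norm_smul, norm_smul] at h
  simp only [Complex.norm_real, norm_inv, norm_norm] at h
  rw [inv_mul_cancel₀ hx'.ne', inv_mul_cancel₀ hy'.ne', ← mul_assoc, ← mul_inv,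
    inv_mul_le_iff₀ (by positivity)] at h
  linarith

theorem exists_integral (E : ProjValuedMeasure H) {g : ℝ → ℂ} (hg : StronglyMeasurable g)
    {C : ℝ} (hC : ∀ t, ‖g t‖ ≤ C) :
    ∃ S : H →L[ℂ] H, ∀ x : H, ⟪x, S x⟫_ℂ = ∫ t, g t ∂(E.vectorMeasure x) := by
  have hC0 : 0 ≤ C := (norm_nonneg _).trans (hC 0)
  set Q : H → ℂ := fun x => ∫ t, g t ∂(E.vectorMeasure x) with hQ
  choose S hS using fun n => E.exists_integral_simple (hg.approxBounded C n)
  have hlim : ∀ x, Tendsto (fun n => ⟪x, S n x⟫_ℂ) atTop (𝓝 (Q x)) := by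
    intro x
    simp only [hS]
    refine tendsto_integral_of_dominated_convergence (fun _ => C)
      (fun n => (SimpleFunc.stronglyMeasurable _).aestronglyMeasurable) (integrable_const C)
      (fun n => .of_forall fun t => hg.norm_approxBounded_le hC0 n t)
      (.of_forall fun t => hg.tendsto_approxBounded_of_norm_le (hC t))
  set B : H → H → ℂ := fun x y => (Q (x + y) - Q (x - y) - Complex.I * Q (x + Complex.I • y)
    + Complex.I * Q (x - Complex.I • y)) / 4 with hBdef
  have hB : ∀ x y, Tendsto (fun n => ⟪x, S n y⟫_ℂ) atTop (𝓝 (B x y)) := by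
    intro x y
    simp only [fun n => polarize (S n) x y]
    exact ((((hlim _).sub (hlim _)).sub ((hlim _).const_mul _)).add
      ((hlim _).const_mul _)).div_const _
  have hQb : ∀ x, ‖Q x‖ ≤ C * ‖x‖ ^ 2 := by
    intro x
    refine (norm_integral_le_of_norm_le_const (.of_forall hC)).trans ?_
    rw [measureReal_def, E.vectorMeasure_univ, ENNReal.toReal_ofReal (sq_nonneg _)]
  have hI : ∀ y : H, ‖Complex.I • y‖ = ‖y‖ := fun y => by simp [norm_smul]
  have hBb : ∀ x y, ‖B x y‖ ≤ C * (‖x‖ ^ 2 + ‖y‖ ^ 2) := by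
    intro x y
    have p1 := parallelogram_law_with_norm ℂ x y
    have p2 := parallelogram_law_with_norm ℂ x (Complex.I • y)
    rw [hI] at p2
    have e : ‖B x y‖ ≤ (‖Q (x + y)‖ + ‖Q (x - y)‖ + ‖Q (x + Complex.I • y)‖
        + ‖Q (x - Complex.I • y)‖) / 4 := by
      rw [hBdef]
      simp only [norm_div, Complex.norm_ofNat]
      gcongr
      refine (norm_add_le _ _).trans ?_
      gcongr
      · refine (norm_sub_le _ _).trans ?_
        gcongr
        · exact norm_sub_le _ _
        · simp
      · simp
    have q1 := hQb (x + y)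
    have q2 := hQb (x - y)
    have q3 := hQb (x + Complex.I • y)
    have q4 := hQb (x - Complex.I • y)
    have r1 : C * ‖x + y‖ ^ 2 + C * ‖x - y‖ ^ 2 = C * (2 * (‖x‖ ^ 2 + ‖y‖ ^ 2)) := by
      rw [← mul_add]; nlinarith
    have r2 : C * ‖x + Complex.I • y‖ ^ 2 + C * ‖x - Complex.I • y‖ ^ 2
        = C * (2 * (‖x‖ ^ 2 + ‖y‖ ^ 2)) := by
      rw [← mul_add]; nlinarith
    linarith
  have hadd1 : ∀ x x' y, B (x + x') y = B x y + B x' y := fun x x' y =>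
    tendsto_nhds_unique (hB _ _) (by
      simp_rw [inner_add_left]; exact (hB _ _).add (hB _ _))
  have hadd2 : ∀ x y y', B x (y + y') = B x y + B x y' := fun x y y' =>
    tendsto_nhds_unique (hB _ _) (by
      simp_rw [map_add, inner_add_right]; exact (hB _ _).add (hB _ _))
  have hsmul1 : ∀ (c : ℂ) x y, B (c • x) y = (starRingEnd ℂ) c * B x y := fun c x y =>
    tendsto_nhds_unique (hB _ _) (by
      simp_rw [inner_smul_left]; exact (hB _ _).const_mul _)
  have hsmul2 : ∀ (c : ℂ) x y, B x (c • y) = c * B x y := fun c x y =>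
    tendsto_nhds_unique (hB _ _) (by
      simp_rw [map_smul, inner_smul_right]; exact (hB _ _).const_mul _)
  have hbound := bound_of_scaling (B := B) (M := C)
    (fun c x y => by
      have := hsmul1 (c : ℂ) x y
      rwa [Complex.conj_ofReal, Complex.coe_smul] at this)
    (fun c x y => by
      have := hsmul2 (c : ℂ) x y
      rwa [Complex.coe_smul] at this) hBb
  let L : H →L⋆[ℂ] H →L[ℂ] ℂ := LinearMap.mkContinuous₂
    (LinearMap.mk₂'ₛₗ (starRingEnd ℂ) (RingHom.id ℂ) B hadd1 hsmul1 hadd2 hsmul2) (2 * C) hbound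
  refine ⟨ContinuousLinearMap.adjoint (InnerProductSpace.continuousLinearMapOfBilin L),
    fun x => ?_⟩
  rw [ContinuousLinearMap.adjoint_inner_right,
    InnerProductSpace.continuousLinearMapOfBilin_apply]
  exact tendsto_nhds_unique (hB x x) (hlim x)

theorem integral_spec (E : ProjValuedMeasure H) {g : ℝ → ℂ} (hg : StronglyMeasurable g)
    {C : ℝ} (hC : ∀ t, ‖g t‖ ≤ C) (x : H) :
    ⟪x, E.integral g x⟫_ℂ = ∫ t, g t ∂(E.vectorMeasure x) := by
  have h := E.exists_integral hg hC
  rw [integral, dif_pos h]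
  exact h.choose_spec x

theorem integral_unique (E : ProjValuedMeasure H) {g : ℝ → ℂ} {S : H →L[ℂ] H}
    (hS : ∀ x : H, ⟪x, S x⟫_ℂ = ∫ t, g t ∂(E.vectorMeasure x)) : E.integral g = S := by
  have h : ∃ S : H →L[ℂ] H, ∀ x : H, ⟪x, S x⟫_ℂ = ∫ t, g t ∂(E.vectorMeasure x) := ⟨S, hS⟩
  rw [integral, dif_pos h]
  ext y
  refine ext_inner_left ℂ fun x => ?_
  rw [polarize, polarize S]
  simp only [h.choose_spec, hS]

end ProjValuedMeasure

open scoped Classical in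
/-- The bounded operator `g(T) = ∫ g dE`, for a self-adjoint operator `T` with spectral measure
`E` and a bounded Borel function `g`. (The value is `0` if `T` has no spectral measure.) -/
def borelFunctionalCalculus {H : Type*} [NormedAddCommGroup H] [InnerProductSpace ℂ H]
    [CompleteSpace H] (T : H →ₗ.[ℂ] H) (g : ℝ → ℂ) : H →L[ℂ] H :=
  if h : ∃ E : ProjValuedMeasure H, E.IsSpectralMeasureOf T then h.choose.integral g else 0

/-! ### Unbounded operators -/

/-- A bounded operator, seen as an operator with domain the whole space. -/
def boundedOp {H : Type*} [NormedAddCommGroup H] [NormedSpace ℂ H] (S : H →L[ℂ] H) :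
    H →ₗ.[ℂ] H :=
  (S : H →ₗ[ℂ] H).toPMap ⊤

/-- The composition `S ∘ T` of unbounded operators on its natural domain
`{x ∈ D(T) : T x ∈ D(S)}`. -/
def opComp {H : Type*} [NormedAddCommGroup H] [NormedSpace ℂ H] (S T : H →ₗ.[ℂ] H) :
    H →ₗ.[ℂ] H where
  domain :=
    { carrier := {x | ∃ h : x ∈ T.domain, T ⟨x, h⟩ ∈ S.domain}
      zero_mem' := ⟨T.domain.zero_mem, by
        rw [show (⟨0, T.domain.zero_mem⟩ : T.domain) = 0 from rfl, LinearPMap.map_zero]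
        exact S.domain.zero_mem⟩
      add_mem' := by
        rintro x y ⟨hx, hx'⟩ ⟨hy, hy'⟩
        refine ⟨T.domain.add_mem hx hy, ?_⟩
        rw [show (⟨x + y, T.domain.add_mem hx hy⟩ : T.domain) = ⟨x, hx⟩ + ⟨y, hy⟩ from rfl,
          LinearPMap.map_add]
        exact S.domain.add_mem hx' hy'
      smul_mem' := by
        rintro c x ⟨hx, hx'⟩
        refine ⟨T.domain.smul_mem c hx, ?_⟩
        rw [show (⟨c • x, T.domain.smul_mem c hx⟩ : T.domain) = c • ⟨x, hx⟩ from rfl,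
          LinearPMap.map_smul]
        exact S.domain.smul_mem c hx' }
  toFun :=
    { toFun := fun x => S ⟨T ⟨x, x.2.1⟩, x.2.2⟩
      map_add' := fun x y => by
        rw [← LinearPMap.map_add]
        congr 1
        ext1
        exact LinearPMap.map_add T ⟨x, x.2.1⟩ ⟨y, y.2.1⟩
      map_smul' := fun c x => by
        rw [RingHom.id_apply, ← LinearPMap.map_smul]
        congr 1
        ext1
        exact LinearPMap.map_smul T c ⟨x, x.2.1⟩ }

/-! ### The operators in `L²(ℝ, ℂ)` -/

/-- The Hilbert space `L²(ℝ, ℂ)` with respect to Lebesgue measure. -/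
abbrev L2R : Type := Lp ℂ 2 (volume : Measure ℝ)

/-- `C₀^∞(ℝ, ℂ)` as a subspace of `L²(ℝ, ℂ)`. -/
def smoothCompact : Submodule ℂ L2R where
  carrier := {u | ∃ φ : ℝ → ℂ, ContDiff ℝ ∞ φ ∧ HasCompactSupport φ ∧ u =ᵐ[volume] φ}
  zero_mem' := ⟨0, contDiff_const, HasCompactSupport.zero, Lp.coeFn_zero _ _ _⟩
  add_mem' := by
    rintro u v ⟨φ, h1, h2, h3⟩ ⟨ψ, k1, k2, k3⟩
    exact ⟨φ + ψ, h1.add k1, h2.add k2, (Lp.coeFn_add u v).trans (h3.add k3)⟩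
  smul_mem' := by
    rintro c u ⟨φ, h1, h2, h3⟩
    exact ⟨c • φ, h1.const_smul c, h2.smul_left (f := fun _ => c),
      (Lp.coeFn_smul c u).trans (h3.const_smul c)⟩

/-- The graph `{(f, (i/K) f') : f ∈ C₀^∞(ℝ, ℂ)}` of the operator `p`. -/
def momentumGraph (K : ℝ) : Submodule ℂ (L2R × L2R) where
  carrier := {w | ∃ φ : ℝ → ℂ, ContDiff ℝ ∞ φ ∧ HasCompactSupport φ ∧ w.1 =ᵐ[volume] φ ∧
    w.2 =ᵐ[volume] fun ξ => (Complex.I / K) * deriv φ ξ}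
  zero_mem' := ⟨0, contDiff_const, HasCompactSupport.zero, Lp.coeFn_zero _ _ _, by
    refine (Lp.coeFn_zero ℂ 2 volume).trans (.of_forall fun ξ => ?_)
    simp [show (0 : ℝ → ℂ) = fun _ => 0 from rfl]⟩
  add_mem' := by
    rintro u v ⟨φ, h1, h2, h3, h4⟩ ⟨ψ, k1, k2, k3, k4⟩
    refine ⟨φ + ψ, h1.add k1, h2.add k2, (Lp.coeFn_add _ _).trans (h3.add k3),
      (Lp.coeFn_add _ _).trans ((h4.add k4).trans (.of_forall fun ξ => ?_))⟩
    have e : deriv (φ + ψ) ξ = deriv φ ξ + deriv ψ ξ :=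
      deriv_add (h1.differentiable (by simp) ξ) (k1.differentiable (by simp) ξ)
    simp only [e, mul_add, Pi.add_apply]
  smul_mem' := by
    rintro c u ⟨φ, h1, h2, h3, h4⟩
    refine ⟨c • φ, h1.const_smul c, h2.smul_left (f := fun _ => c),
      (Lp.coeFn_smul _ _).trans (h3.const_smul c),
      (Lp.coeFn_smul _ _).trans ((h4.const_smul c).trans (.of_forall fun ξ => ?_))⟩
    have e : deriv (c • φ) ξ = c • deriv φ ξ :=
      deriv_const_smul c (h1.differentiable (by simp) ξ)
    simp only [e, smul_eq_mul, Pi.smul_apply]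
    ring

/-- The operator `p : C₀^∞(ℝ, ℂ) → L²(ℝ, ℂ)`, `f ↦ (i/K) f'`. -/
def momentum (K : ℝ) : L2R →ₗ.[ℂ] L2R := (momentumGraph K).toLinearPMap

theorem momentum_graph (K : ℝ) : (momentum K).graph = momentumGraph K := by
  refine Submodule.toLinearPMap_graph_eq _ ?_
  rintro ⟨u, v⟩ ⟨φ, h1, h2, h3, h4⟩ (h0 : u = 0)
  subst h0
  have hφ : φ = 0 := by
    refine Continuous.ae_eq_iff_eq volume h1.continuous continuous_const |>.mp ?_
    exact h3.symm.trans (Lp.coeFn_zero ℂ 2 volume)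
  subst hφ
  refine Lp.ext (h4.trans (EventuallyEq.trans (.of_forall fun ξ => ?_)
    (Lp.coeFn_zero ℂ 2 volume).symm))
  simp [show (0 : ℝ → ℂ) = fun _ => 0 from rfl]

/-- The closure `p̄` of `p`. -/
def momentumBar (K : ℝ) : L2R →ₗ.[ℂ] L2R := (momentum K).closure

/-- The maximal multiplication operator by a function `g` in `L²(ℝ, ℂ)`, with domain
`{u ∈ L² : g u ∈ L²}`. -/
def mulOp (g : ℝ → ℂ) : L2R →ₗ.[ℂ] L2R where
  domain :=
    { carrier := {u | MemLp (fun ξ => g ξ * u ξ) 2 volume}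
      zero_mem' := by
        refine MemLp.ae_eq (EventuallyEq.symm ?_) (MemLp.zero' (ε := ℂ))
        filter_upwards [Lp.coeFn_zero ℂ 2 (volume : Measure ℝ)] with ξ h
        rw [h]; simp
      add_mem' := by
        intro u v hu hv
        refine MemLp.ae_eq ?_ (MemLp.add hu hv)
        filter_upwards [Lp.coeFn_add u v] with ξ h
        rw [h]; simp [mul_add]
      smul_mem' := by
        intro c u hu
        refine MemLp.ae_eq ?_ (MemLp.const_smul hu c)
        filter_upwards [Lp.coeFn_smul c u] with ξ h
        rw [h]; simp only [Pi.smul_apply, smul_eq_mul]; ring }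
  toFun :=
    { toFun := fun u => MemLp.toLp (fun ξ => g ξ * (u : L2R) ξ) u.2
      map_add' := fun u v => by
        rw [← MemLp.toLp_add, MemLp.toLp_eq_toLp_iff]
        filter_upwards [Lp.coeFn_add (u : L2R) (v : L2R)] with ξ h
        rw [Submodule.coe_add, h]; simp [mul_add]
      map_smul' := fun c u => by
        rw [RingHom.id_apply, ← MemLp.toLp_const_smul, MemLp.toLp_eq_toLp_iff]
        filter_upwards [Lp.coeFn_smul c (u : L2R)] with ξ h
        rw [Submodule.coe_smul, h]; simp only [Pi.smul_apply, smul_eq_mul]; ring }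

/-- `B^{1/2}`: the maximal multiplication operator by `ξ ↦ e^{-Kξ}`. -/
def BHalf (K : ℝ) : L2R →ₗ.[ℂ] L2R := mulOp fun ξ => (Real.exp (-(K * ξ)) : ℂ)

/-- `B^{-1/2}`: the maximal multiplication operator by `ξ ↦ e^{Kξ}`. -/
def BNegHalf (K : ℝ) : L2R →ₗ.[ℂ] L2R := mulOp fun ξ => (Real.exp (K * ξ) : ℂ)

/-! ### The function class -/

/-- The restriction `f(·, y)` of `f` to the horizontal line at height `y`. -/
def lineSlice (f : ℂ → ℂ) (y : ℝ) : ℝ → ℂ := fun x => f (⟨x, y⟩ : ℂ)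

/-- The class `𝒜` of functions on the strip `ℝ × [-1, 0] ⊆ ℂ`. (Values of `f` outside the strip
are irrelevant.) -/
structure StripClass (f : ℂ → ℂ) : Prop where
  measurable_top : StronglyMeasurable (lineSlice f 0)
  bounded_top : ∃ C : ℝ, ∀ x, ‖lineSlice f 0 x‖ ≤ C
  measurable_bot : StronglyMeasurable (lineSlice f (-1))
  bounded_bot : ∃ C : ℝ, ∀ x, ‖lineSlice f (-1) x‖ ≤ C
  tendsto_top : ∀ᵐ x : ℝ, Tendsto (fun y => lineSlice f y x) (𝓝[<] 0) (𝓝 (lineSlice f 0 x))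
  tendsto_bot : ∀ᵐ x : ℝ,
    Tendsto (fun y => lineSlice f y x) (𝓝[>] (-1)) (𝓝 (lineSlice f (-1) x))
  holomorphic : DifferentiableOn ℂ f {z : ℂ | -1 < z.im ∧ z.im < 0}
  poly_bounded : ∃ C : ℝ, 0 ≤ C ∧ ∃ N : ℕ, ∀ z : ℂ, -1 ≤ z.im → z.im ≤ 0 →
    ‖f z‖ ≤ C * (1 + ‖z‖) ^ N

/-- The operator `B^{-1/2} g(p̄) B^{1/2}` on its natural domain. -/
def conjugatedOp (K : ℝ) (g : ℝ → ℂ) : L2R →ₗ.[ℂ] L2R :=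
  opComp (BNegHalf K) (opComp (boundedOp (borelFunctionalCalculus (momentumBar K) g)) (BHalf K))

end

/-! The Fourier transform turns `momentumBar K` into multiplication by the real symbol `t ↦ -(2π/K)
t`, so `g(p̄)` is the Fourier multiplier with symbol `g(-(2π/K) t)`. For test functions `φ`, `ψ` the
matrix element `⟪φ, g(p̄) ψ⟫` is therefore a constant times `∫ g(s) A(s) B(s) ds`, where `A`, `B`
are Fourier-Laplace transforms of `conj φ` and `ψ`: entire, and rapidly decreasing on horizontal
strips. Replacing `φ` by `e^{Kξ} φ` and `ψ` by `e^{-Kξ} ψ` shifts the argument of both transforms by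
`+i`. Cauchy's theorem moves the line of integration of `f(z) A(z+i) B(z+i)` from `Im z = 0` to `Im
z = -1`, which undoes the shift and puts `f(·, -1)` in place of `f(·, 0)` (`StripClass.integral_eq`,
`StripClass.inner_eq`).

The identity extends from test functions `ψ` to all of `D(B^{1/2})` by continuity, after
parametrising that domain by bounded multipliers (`StripClass.inner_eq_domain`). Testing against all
`φ` gives `e^{Kξ} f(p̄,0) B^{1/2} u = f(p̄,-1) u` almost everywhere (`StripClass.ae_eq`). So the
conjugated operator is the restriction of a bounded operator to the dense domain `D(B^{1/2})`, and
its closure is that bounded operator.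

Since the functional calculus selects a spectral measure by choice, the Fourier description needs
two further facts. A spectral measure is unique, because it is determined by the resolvent at `i`
(`IsSpectralMeasureOf.unique`). The Fourier one does belong to the closure of the operator on test
functions, because `p - i` has dense range there (`dense_range_shift`,
`topologicalClosure_momentumGraph`). -/

namespace ProjValuedMeasure

/-! ### Multiplicativity of the bounded functional calculus -/

variable {H : Type*} [NormedAddCommGroup H] [InnerProductSpace ℂ H] [CompleteSpace H]

theorem clm_ext_of_inner_self {S T : H →L[ℂ] H} (h : ∀ x, ⟪x, S x⟫_ℂ = ⟪x, T x⟫_ℂ) : S = T := by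
  ext y
  refine ext_inner_left ℂ fun x => ?_
  rw [polarize, polarize T]
  simp only [h]

theorem proj_idem (E : ProjValuedMeasure H) {s : Set ℝ} (hs : MeasurableSet s) :
    E.proj s * E.proj s = E.proj s :=
  (E.isStarProjection s hs).isIdempotentElem

theorem proj_union (E : ProjValuedMeasure H) {s t : Set ℝ} (hs : MeasurableSet s)
    (ht : MeasurableSet t) (hst : Disjoint s t) : E.proj (s ∪ t) = E.proj s + E.proj t := by
  refine clm_ext_of_inner_self fun x => ?_
  have h : (E.vectorMeasure x).real (s ∪ t) = _ := measureReal_union hst ht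
  rw [E.vectorMeasure_real x (hs.union ht), E.vectorMeasure_real x hs,
    E.vectorMeasure_real x ht] at h
  rw [_root_.add_apply, inner_add_right, E.inner_proj (hs.union ht), E.inner_proj hs,
    E.inner_proj ht, h]
  push_cast
  rfl

/-- Since `P + Q` is again a projection, `PQ + QP = 0`. Multiplying by `P` on the left shows that
`PQ` and `QP` are also equal, so `2PQ = 0`. -/
theorem proj_mul_of_disjoint (E : ProjValuedMeasure H) {s t : Set ℝ} (hs : MeasurableSet s)
    (ht : MeasurableSet t) (hst : Disjoint s t) : E.proj s * E.proj t = 0 := by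
  have h := E.proj_idem (hs.union ht)
  rw [E.proj_union hs ht hst] at h
  have h1 := E.proj_idem hs
  have h2 := E.proj_idem ht
  generalize E.proj s = P at *
  generalize E.proj t = Q at *
  have h3 : P * Q + Q * P = 0 := by
    have : (P + Q) * (P + Q) = P * P + Q * Q + (P * Q + Q * P) := by noncomm_ring
    rw [this, h1, h2] at h
    simpa using h
  have h4 : P * Q = - (Q * P) := eq_neg_of_add_eq_zero_left h3
  have h5 : P * Q = - (P * (Q * P)) := by
    calc P * Q = (P * P) * Q := by rw [h1]
      _ = P * (P * Q) := by noncomm_ring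
      _ = _ := by rw [h4]; noncomm_ring
  have h6 : P * (Q * P) = - (Q * P) := by
    calc P * (Q * P) = (P * Q) * P := by noncomm_ring
      _ = - (Q * (P * P)) := by rw [h4]; noncomm_ring
      _ = _ := by rw [h1]
  have h7 : P * Q = Q * P := by rw [h5, h6, neg_neg]
  have h8 : (2 : ℂ) • (P * Q) = 0 := by rw [two_smul]; nth_rw 2 [h7]; exact h3
  simpa using h8

theorem proj_mul (E : ProjValuedMeasure H) {s t : Set ℝ} (hs : MeasurableSet s)
    (ht : MeasurableSet t) : E.proj s * E.proj t = E.proj (s ∩ t) := by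
  have e1 : E.proj s = E.proj (s ∩ t) + E.proj (s \ t) := by
    rw [← E.proj_union (hs.inter ht) (hs.diff ht) (by
      exact Set.disjoint_sdiff_inter.symm), Set.inter_union_sdiff]
  have e2 : E.proj t = E.proj (s ∩ t) + E.proj (t \ s) := by
    rw [← E.proj_union (hs.inter ht) (ht.diff hs) (by
      rw [Set.inter_comm]; exact Set.disjoint_sdiff_inter.symm), Set.inter_comm,
      Set.inter_union_sdiff]
  have d1 : Disjoint (s ∩ t) (t \ s) := by
    rw [Set.inter_comm]; exact Set.disjoint_sdiff_inter.symm
  have d2 : Disjoint (s \ t) (s ∩ t) := Set.disjoint_sdiff_inter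
  have d3 : Disjoint (s \ t) (t \ s) := disjoint_sdiff_sdiff
  rw [e1, e2, mul_add, add_mul, add_mul, E.proj_mul_of_disjoint (hs.diff ht) (hs.inter ht) d2,
    E.proj_mul_of_disjoint (hs.diff ht) (ht.diff hs) d3,
    E.proj_mul_of_disjoint (hs.inter ht) (ht.diff hs) d1, E.proj_idem (hs.inter ht)]
  simp

theorem integrable_of_bound (E : ProjValuedMeasure H) {g : ℝ → ℂ} (hg : StronglyMeasurable g)
    {C : ℝ} (hC : ∀ t, ‖g t‖ ≤ C) (x : H) : Integrable g (E.vectorMeasure x) :=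
  .of_bound hg.aestronglyMeasurable C (.of_forall hC)

theorem integral_add (E : ProjValuedMeasure H) {g h : ℝ → ℂ} (hg : StronglyMeasurable g)
    (hh : StronglyMeasurable h) {C D : ℝ} (hC : ∀ t, ‖g t‖ ≤ C) (hD : ∀ t, ‖h t‖ ≤ D) :
    E.integral (g + h) = E.integral g + E.integral h :=
  E.integral_unique fun x => by
    rw [_root_.add_apply, inner_add_right, E.integral_spec hg hC, E.integral_spec hh hD]
    exact (MeasureTheory.integral_add (E.integrable_of_bound hg hC x)
      (E.integrable_of_bound hh hD x)).symm

theorem integral_conj (E : ProjValuedMeasure H) {g : ℝ → ℂ} (hg : StronglyMeasurable g)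
    {C : ℝ} (hC : ∀ t, ‖g t‖ ≤ C) :
    E.integral (fun t => (starRingEnd ℂ) (g t)) = ContinuousLinearMap.adjoint (E.integral g) :=
  E.integral_unique fun x => by
    rw [ContinuousLinearMap.adjoint_inner_right, ← inner_conj_symm, E.integral_spec hg hC]
    exact _root_.integral_conj.symm

theorem integral_indicator_const (E : ProjValuedMeasure H) {s : Set ℝ} (hs : MeasurableSet s)
    (c : ℂ) : E.integral (s.indicator fun _ => c) = c • E.proj s :=
  E.integral_unique fun x => by
    rw [MeasureTheory.integral_indicator_const c hs, E.vectorMeasure_real x hs,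
      Complex.real_smul, _root_.smul_apply, inner_smul_right, E.inner_proj hs, mul_comm]

theorem integral_const (E : ProjValuedMeasure H) (c : ℂ) : E.integral (fun _ => c) = c • 1 := by
  have h := E.integral_indicator_const MeasurableSet.univ c
  rwa [Set.indicator_univ, E.proj_univ] at h

/-- Dominated convergence treats the diagonal matrix elements, where the spectral measures are
positive; polarization gives the rest. Only weak convergence is needed to pass from simple to
bounded Borel functions. -/
theorem tendsto_inner_integral (E : ProjValuedMeasure H) {g : ℝ → ℂ} {G : ℕ → ℝ → ℂ}
    (hg : StronglyMeasurable g) (hG : ∀ n, StronglyMeasurable (G n)) {C : ℝ}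
    (hC : ∀ n t, ‖G n t‖ ≤ C) (hlim : ∀ t, Tendsto (fun n => G n t) atTop (𝓝 (g t)))
    (x y : H) :
    Tendsto (fun n => ⟪x, E.integral (G n) y⟫_ℂ) atTop (𝓝 ⟪x, E.integral g y⟫_ℂ) := by
  have hgC : ∀ t, ‖g t‖ ≤ C := fun t =>
    le_of_tendsto (hlim t).norm (.of_forall fun n => hC n t)
  have h : ∀ x, Tendsto (fun n => ⟪x, E.integral (G n) x⟫_ℂ) atTop
      (𝓝 ⟪x, E.integral g x⟫_ℂ) := by
    intro x
    simp only [E.integral_spec hg hgC, fun n => E.integral_spec (hG n) (hC n)]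
    exact tendsto_integral_of_dominated_convergence (fun _ => C)
      (fun n => (hG n).aestronglyMeasurable) (integrable_const C)
      (fun n => .of_forall (hC n)) (.of_forall hlim)
  rw [polarize]
  simp only [fun n => polarize (E.integral (G n)) x y]
  exact ((((h _).sub (h _)).sub ((h _).const_mul _)).add ((h _).const_mul _)).div_const _

theorem integral_mul_indicator (E : ProjValuedMeasure H) (g : SimpleFunc ℝ ℂ) {s : Set ℝ}
    (hs : MeasurableSet s) (c : ℂ) :
    E.integral (fun t => g t * s.indicator (fun _ => c) t) =
      E.integral g * E.integral (s.indicator fun _ => c) := by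
  have hb : ∀ t, ‖s.indicator (fun _ => c) t‖ ≤ ‖c‖ := fun t => norm_indicator_le_norm_self _ _
  have hm : StronglyMeasurable (s.indicator fun _ : ℝ => c) :=
    stronglyMeasurable_const.indicator hs
  induction g using SimpleFunc.induction with
  | const d ht =>
    rename_i t
    simp only [SimpleFunc.coe_piecewise, SimpleFunc.coe_const, Function.const_zero,
      Set.piecewise_eq_indicator]
    rw [show (Function.const ℝ d) = fun _ => d from rfl, E.integral_indicator_const hs,
      E.integral_indicator_const ht, smul_mul_smul_comm, E.proj_mul ht hs,
      ← E.integral_indicator_const (ht.inter hs)]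
    congr 1
    ext u
    by_cases h1 : u ∈ t <;> by_cases h2 : u ∈ s <;> simp [h1, h2]
  | add _ h1 h2 =>
    rename_i f g _
    obtain ⟨Cf, hCf⟩ := f.exists_forall_norm_le
    obtain ⟨Cg, hCg⟩ := g.exists_forall_norm_le
    rw [SimpleFunc.coe_add, E.integral_add f.stronglyMeasurable g.stronglyMeasurable hCf hCg,
      add_mul, ← h1, ← h2]
    refine (congrArg E.integral ?_).trans (E.integral_add (C := Cf * ‖c‖) (D := Cg * ‖c‖)
      (f.stronglyMeasurable.mul hm) (g.stronglyMeasurable.mul hm) ?_ ?_)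
    · ext t
      simp [add_mul]
    · intro t
      rw [norm_mul]
      exact mul_le_mul (hCf t) (hb t) (norm_nonneg _) ((norm_nonneg _).trans (hCf t))
    · intro t
      rw [norm_mul]
      exact mul_le_mul (hCg t) (hb t) (norm_nonneg _) ((norm_nonneg _).trans (hCg t))

theorem integral_mul_simpleFunc (E : ProjValuedMeasure H) (g h : SimpleFunc ℝ ℂ) :
    E.integral (fun t => g t * h t) = E.integral g * E.integral h := by
  induction h using SimpleFunc.induction with
  | const d ht =>
    simp only [SimpleFunc.coe_piecewise, SimpleFunc.coe_const, Function.const_zero,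
      Set.piecewise_eq_indicator]
    exact E.integral_mul_indicator g ht d
  | add _ h1 h2 =>
    rename_i f f' _
    obtain ⟨Cf, hCf⟩ := f.exists_forall_norm_le
    obtain ⟨Cf', hCf'⟩ := f'.exists_forall_norm_le
    obtain ⟨Cg, hCg⟩ := g.exists_forall_norm_le
    rw [SimpleFunc.coe_add, E.integral_add f.stronglyMeasurable f'.stronglyMeasurable hCf hCf',
      mul_add, ← h1, ← h2]
    refine (congrArg E.integral ?_).trans (E.integral_add (C := Cg * Cf) (D := Cg * Cf')
      (g.stronglyMeasurable.mul f.stronglyMeasurable)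
      (g.stronglyMeasurable.mul f'.stronglyMeasurable) ?_ ?_)
    · ext t
      simp [mul_add]
    · intro t
      rw [norm_mul]
      exact mul_le_mul (hCg t) (hCf t) (norm_nonneg _) ((norm_nonneg _).trans (hCg t))
    · intro t
      rw [norm_mul]
      exact mul_le_mul (hCg t) (hCf' t) (norm_nonneg _) ((norm_nonneg _).trans (hCg t))

theorem integral_mul (E : ProjValuedMeasure H) {g h : ℝ → ℂ} (hg : StronglyMeasurable g)
    (hh : StronglyMeasurable h) {C D : ℝ} (hC : ∀ t, ‖g t‖ ≤ C) (hD : ∀ t, ‖h t‖ ≤ D) :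
    E.integral (fun t => g t * h t) = E.integral g * E.integral h := by
  have hC0 : 0 ≤ C := (norm_nonneg _).trans (hC 0)
  have hD0 : 0 ≤ D := (norm_nonneg _).trans (hD 0)
  -- The two factors are approximated one at a time, because weak convergence does not pass to
  -- products. For the second factor, the fixed operator `E.integral g` is moved to the left of the
  -- inner product as its adjoint.
  have key : ∀ k : SimpleFunc ℝ ℂ,
      E.integral (fun t => g t * k t) = E.integral g * E.integral k := by
    intro k
    obtain ⟨Ck, hCk⟩ := k.exists_forall_norm_le
    ext y
    refine ext_inner_left ℂ fun x => ?_
    have l1 := E.tendsto_inner_integral (G := fun n t => hg.approxBounded C n t * k t)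
      (C := C * Ck) (hg.mul k.stronglyMeasurable)
      (fun n => (SimpleFunc.stronglyMeasurable _).mul k.stronglyMeasurable)
      (fun n t => by
        rw [norm_mul]
        exact mul_le_mul (hg.norm_approxBounded_le hC0 n t) (hCk t) (norm_nonneg _) hC0)
      (fun t => (hg.tendsto_approxBounded_of_norm_le (hC t)).mul_const _) x y
    have l2 := E.tendsto_inner_integral (G := fun n t => hg.approxBounded C n t)
      (C := C) hg (fun n => SimpleFunc.stronglyMeasurable _)
      (fun n t => hg.norm_approxBounded_le hC0 n t)
      (fun t => hg.tendsto_approxBounded_of_norm_le (hC t)) x (E.integral k y)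
    refine tendsto_nhds_unique l1 ?_
    simp only [E.integral_mul_simpleFunc]
    exact l2
  ext y
  refine ext_inner_left ℂ fun x => ?_
  have l1 := E.tendsto_inner_integral (G := fun n t => g t * hh.approxBounded D n t)
    (C := C * D) (hg.mul hh) (fun n => hg.mul (SimpleFunc.stronglyMeasurable _))
    (fun n t => by
      rw [norm_mul]
      exact mul_le_mul (hC t) (hh.norm_approxBounded_le hD0 n t) (norm_nonneg _) hC0)
    (fun t => (hh.tendsto_approxBounded_of_norm_le (hD t)).const_mul _) x y
  have l2 := E.tendsto_inner_integral (G := fun n t => hh.approxBounded D n t)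
    (C := D) hh (fun n => SimpleFunc.stronglyMeasurable _)
    (fun n t => hh.norm_approxBounded_le hD0 n t)
    (fun t => hh.tendsto_approxBounded_of_norm_le (hD t))
    (ContinuousLinearMap.adjoint (E.integral g) x) y
  refine tendsto_nhds_unique l1 ?_
  simp only [key]
  simp only [ContinuousLinearMap.adjoint_inner_left] at l2
  exact l2

theorem norm_sq_integral (E : ProjValuedMeasure H) {g : ℝ → ℂ} (hg : StronglyMeasurable g)
    {C : ℝ} (hC : ∀ t, ‖g t‖ ≤ C) (x : H) :
    ‖E.integral g x‖ ^ 2 = ∫ t, ‖g t‖ ^ 2 ∂(E.vectorMeasure x) := by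
  have hconj : StronglyMeasurable fun t => (starRingEnd ℂ) (g t) :=
    Complex.continuous_conj.comp_stronglyMeasurable hg
  have hconjC : ∀ t, ‖(starRingEnd ℂ) (g t)‖ ≤ C := fun t => by simpa using hC t
  have hC0 : 0 ≤ C := (norm_nonneg _).trans (hC 0)
  have h : ⟪E.integral g x, E.integral g x⟫_ℂ = ∫ t, (‖g t‖ ^ 2 : ℂ) ∂(E.vectorMeasure x) := by
    rw [← ContinuousLinearMap.adjoint_inner_right, ← E.integral_conj hg hC]
    have := E.integral_spec (hconj.mul hg) (C := C * C) (fun t => by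
      simp only [Pi.mul_apply, norm_mul]
      exact mul_le_mul (hconjC t) (hC t) (norm_nonneg _) hC0) x
    rw [show ((fun t => (starRingEnd ℂ) (g t)) * g) = fun t => (starRingEnd ℂ) (g t) * g t from rfl,
      E.integral_mul hconj hg hconjC hC] at this
    refine this.trans ?_
    simp only [Complex.conj_mul']
  rw [inner_self_eq_norm_sq_to_K] at h
  have h2 : ∫ t, (‖g t‖ ^ 2 : ℂ) ∂(E.vectorMeasure x)
      = ((∫ t, ‖g t‖ ^ 2 ∂(E.vectorMeasure x) : ℝ) : ℂ) := by
    rw [← integral_complex_ofReal]; simp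
  rw [h2] at h
  refine Complex.ofReal_injective ?_
  rw [← h]
  simp

/-- By multiplicativity `‖E(s) g(E) x‖² = ∫ |1_s g|² dμ_x`. This density formula is what decides
whether `g(E) x` lies in the domain of the unbounded operator. -/
theorem vectorMeasure_integral (E : ProjValuedMeasure H) {g : ℝ → ℂ} (hg : StronglyMeasurable g)
    {C : ℝ} (hC : ∀ t, ‖g t‖ ≤ C) (x : H) :
    E.vectorMeasure (E.integral g x) =
      (E.vectorMeasure x).withDensity fun t => ENNReal.ofReal (‖g t‖ ^ 2) := by
  have hC0 : 0 ≤ C := (norm_nonneg _).trans (hC 0)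
  ext s hs
  rw [E.vectorMeasure_apply _ hs, withDensity_apply _ hs]
  have hm : StronglyMeasurable (s.indicator fun _ : ℝ => (1 : ℂ)) :=
    stronglyMeasurable_const.indicator hs
  have hb : ∀ t, ‖s.indicator (fun _ => (1 : ℂ)) t‖ ≤ 1 := fun t =>
    (norm_indicator_le_norm_self _ _).trans (by simp)
  have h1 : E.proj s = E.integral (s.indicator fun _ => 1) := by
    rw [E.integral_indicator_const hs, one_smul]
  have h2 : E.proj s (E.integral g x) =
      E.integral (fun t => s.indicator (fun _ => (1 : ℂ)) t * g t) x := by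
    rw [E.integral_mul hm hg hb hC, ← h1]; rfl
  have h3 : ‖E.integral (fun t => s.indicator (fun _ => (1 : ℂ)) t * g t) x‖ ^ 2 =
      ∫ t, ‖s.indicator (fun _ => (1 : ℂ)) t * g t‖ ^ 2 ∂(E.vectorMeasure x) :=
    E.norm_sq_integral (hm.mul hg) (C := 1 * C) (fun t => by
      simp only [Pi.mul_apply, norm_mul]
      exact mul_le_mul (hb t) (hC t) (norm_nonneg _) zero_le_one) x
  rw [h2, h3]
  rw [ofReal_integral_eq_lintegral_ofReal, ← lintegral_indicator hs]
  · congr 1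
    ext t
    by_cases ht : t ∈ s <;> simp [ht]
  · refine Integrable.of_bound (C := C ^ 2)
      ((hm.mul hg).norm.pow 2).aestronglyMeasurable (.of_forall fun t => ?_)
    simp only [norm_mul, norm_pow, norm_norm]
    refine pow_le_pow_left₀ (by positivity) ?_ 2
    calc _ ≤ 1 * C := mul_le_mul (hb t) (hC t) (norm_nonneg _) zero_le_one
      _ = C := one_mul C
  · exact .of_forall fun t => sq_nonneg _

theorem ext_of_vectorMeasure {E E' : ProjValuedMeasure H}
    (h : ∀ x, E.vectorMeasure x = E'.vectorMeasure x) : E = E' := by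
  ext1
  funext s
  by_cases hs : MeasurableSet s
  · refine clm_ext_of_inner_self fun x => ?_
    rw [E.inner_proj hs, E'.inner_proj hs, ← E.vectorMeasure_real x hs,
      ← E'.vectorMeasure_real x hs, h]
  · rw [E.not_measurable s hs, E'.not_measurable s hs]

end ProjValuedMeasure

/-! ### Uniqueness of the spectral measure, through the resolvent -/

namespace ProjValuedMeasure

theorem polarize_linearPMap {H : Type*} [NormedAddCommGroup H] [InnerProductSpace ℂ H]
    (T : H →ₗ.[ℂ] H) (x y : T.domain) :
    ⟪(x : H), T y⟫_ℂ = (⟪((x + y : T.domain) : H), T (x + y)⟫_ℂ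
      - ⟪((x - y : T.domain) : H), T (x - y)⟫_ℂ
      - Complex.I * ⟪((x + Complex.I • y : T.domain) : H), T (x + Complex.I • y)⟫_ℂ
      + Complex.I * ⟪((x - Complex.I • y : T.domain) : H), T (x - Complex.I • y)⟫_ℂ) / 4 := by
  simp only [LinearPMap.map_add, LinearPMap.map_sub, LinearPMap.map_smul, Submodule.coe_add,
    Submodule.coe_sub, Submodule.coe_smul, inner_add_left, inner_add_right, inner_sub_left,
    inner_sub_right, inner_smul_left, inner_smul_right, Complex.conj_I]
  ring_nf
  simp only [Complex.I_sq]
  ring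

variable {H : Type*} [NormedAddCommGroup H] [InnerProductSpace ℂ H] [CompleteSpace H]

/-- The identity function cut off to `0` outside `[-n, n]`. -/
noncomputable def cutoffId (n : ℕ) : ℝ → ℂ :=
  (Set.Icc (-(n : ℝ)) n).indicator fun t => (t : ℂ)

theorem stronglyMeasurable_cutoffId (n : ℕ) : StronglyMeasurable (cutoffId n) :=
  Complex.continuous_ofReal.stronglyMeasurable.indicator measurableSet_Icc

theorem norm_cutoffId_le_abs (n : ℕ) (t : ℝ) : ‖cutoffId n t‖ ≤ |t| :=
  (norm_indicator_le_norm_self _ _).trans (by simp)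

theorem norm_cutoffId_le (n : ℕ) (t : ℝ) : ‖cutoffId n t‖ ≤ n := by
  by_cases h : t ∈ Set.Icc (-(n : ℝ)) n
  · rw [cutoffId, Set.indicator_of_mem h, Complex.norm_real]
    exact abs_le.mpr h
  · rw [cutoffId, Set.indicator_of_notMem h]
    simp

theorem eventually_mem_Icc_nat (t : ℝ) : ∀ᶠ n : ℕ in atTop, t ∈ Set.Icc (-(n : ℝ)) n := by
  filter_upwards [eventually_ge_atTop ⌈|t|⌉₊] with n hn
  exact abs_le.mp ((Nat.le_ceil _).trans (by exact_mod_cast hn))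

theorem tendsto_cutoffId (t : ℝ) : Tendsto (fun n => cutoffId n t) atTop (𝓝 (t : ℂ)) := by
  refine tendsto_const_nhds.congr' ?_
  filter_upwards [eventually_mem_Icc_nat t] with n hn
  rw [cutoffId, Set.indicator_of_mem hn]

namespace IsSpectralMeasureOf

variable {E : ProjValuedMeasure H} {T : H →ₗ.[ℂ] H}

theorem integrable_abs (hE : E.IsSpectralMeasureOf T) (x : T.domain) :
    Integrable (fun t : ℝ => |t|) (E.vectorMeasure (x : H)) := by
  have h : MemLp (fun t : ℝ => t) 2 (E.vectorMeasure (x : H)) := by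
    rw [memLp_two_iff_integrable_sq measurable_id'.aestronglyMeasurable]
    refine ⟨(measurable_id.pow_const 2).aestronglyMeasurable, ?_⟩
    have := (hE.1 x).mp x.2
    rw [hasFiniteIntegral_iff_ofReal (.of_forall fun t => sq_nonneg t)]
    exact this
  exact (h.integrable (by norm_num)).abs

/-- `IsSpectralMeasureOf` only prescribes the quadratic form of `T`; polarization on the domain
recovers `T` as a weak limit of truncations, with `|t|` as the integrable majorant. -/
theorem tendsto_inner (hE : E.IsSpectralMeasureOf T) (x y : T.domain) :
    Tendsto (fun n => ⟪(x : H), E.integral (cutoffId n) (y : H)⟫_ℂ) atTop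
      (𝓝 ⟪(x : H), T y⟫_ℂ) := by
  have h : ∀ x : T.domain, Tendsto (fun n => ⟪(x : H), E.integral (cutoffId n) (x : H)⟫_ℂ) atTop
      (𝓝 ⟪(x : H), T x⟫_ℂ) := by
    intro x
    simp only [hE.2 x, fun n => E.integral_spec (stronglyMeasurable_cutoffId n)
      (norm_cutoffId_le n)]
    exact tendsto_integral_of_dominated_convergence (fun t => |t|)
      (fun n => (stronglyMeasurable_cutoffId n).aestronglyMeasurable) (hE.integrable_abs x)
      (fun n => .of_forall (norm_cutoffId_le_abs n)) (.of_forall tendsto_cutoffId)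
  rw [polarize_linearPMap]
  simp only [fun n => polarize (E.integral (cutoffId n)) (x : H) y]
  exact ((((h (x + y)).sub (h (x - y))).sub ((h (x + Complex.I • y)).const_mul _)).add
    ((h (x - Complex.I • y)).const_mul _)).div_const _

/-- The domain is dense: it contains `E([-n, n]) z` for all `n`, and these vectors tend weakly to
`z`. -/
theorem eq_zero_of_orthogonal (hE : E.IsSpectralMeasureOf T) {z : H}
    (hz : ∀ v : T.domain, ⟪(v : H), z⟫_ℂ = 0) : z = 0 := by
  have hm : ∀ n : ℕ, StronglyMeasurable ((Set.Icc (-(n : ℝ)) n).indicator fun _ => (1 : ℂ)) :=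
    fun n => stronglyMeasurable_const.indicator measurableSet_Icc
  have hb : ∀ (n : ℕ) t, ‖(Set.Icc (-(n : ℝ)) n).indicator (fun _ => (1 : ℂ)) t‖ ≤ 1 :=
    fun n t => (norm_indicator_le_norm_self _ _).trans (by simp)
  have h := E.tendsto_inner_integral (g := fun _ => 1) stronglyMeasurable_const hm hb (fun t => by
    refine tendsto_const_nhds.congr' ?_
    filter_upwards [eventually_mem_Icc_nat t] with n hn
    rw [Set.indicator_of_mem hn]) z z
  have h0 : ∀ n : ℕ,
      ⟪z, E.integral ((Set.Icc (-(n : ℝ)) n).indicator fun _ => (1 : ℂ)) z⟫_ℂ = 0 := by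
    intro n
    have hd : E.integral ((Set.Icc (-(n : ℝ)) n).indicator fun _ => (1 : ℂ)) z ∈ T.domain := by
      rw [hE.1, E.vectorMeasure_integral (hm n) (hb n), lintegral_withDensity_eq_lintegral_mul _
        ((hm n).norm.measurable.pow_const 2).ennreal_ofReal (by fun_prop)]
      refine lt_of_le_of_lt (lintegral_mono (g := fun _ => ENNReal.ofReal (n ^ 2)) fun t => ?_) ?_
      · simp only [Pi.mul_apply]
        rw [← ENNReal.ofReal_mul (by positivity)]
        refine ENNReal.ofReal_le_ofReal ?_
        by_cases ht : t ∈ Set.Icc (-(n : ℝ)) n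
        · rw [Set.indicator_of_mem ht]
          simpa using sq_le_sq' ht.1 ht.2
        · rw [Set.indicator_of_notMem ht]
          simp
      · rw [lintegral_const]
        exact ENNReal.mul_lt_top ENNReal.ofReal_lt_top (measure_lt_top _ _)
    rw [← inner_conj_symm, hz ⟨_, hd⟩, map_zero]
  simp only [h0] at h
  have h2 := tendsto_nhds_unique tendsto_const_nhds h
  rw [E.integral_const, one_smul] at h2
  exact inner_self_eq_zero.mp h2.symm

end IsSpectralMeasureOf

/-- The resolvent function `t ↦ (t - i)⁻¹`. -/
noncomputable def resolventFun (t : ℝ) : ℂ := ((t : ℂ) - Complex.I)⁻¹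

theorem ofReal_sub_I_ne_zero (t : ℝ) : (t : ℂ) - Complex.I ≠ 0 := fun h => by
  simpa using congrArg Complex.im h

theorem continuous_resolventFun : Continuous resolventFun :=
  (Complex.continuous_ofReal.sub continuous_const).inv₀ ofReal_sub_I_ne_zero

theorem norm_sq_ofReal_sub_I (t : ℝ) : ‖(t : ℂ) - Complex.I‖ ^ 2 = t ^ 2 + 1 := by
  rw [← Complex.normSq_eq_norm_sq, Complex.normSq_apply]
  simp
  ring

theorem norm_resolventFun_le (t : ℝ) : ‖resolventFun t‖ ≤ 1 := by
  rw [resolventFun, norm_inv]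
  refine inv_le_one_of_one_le₀ ?_
  nlinarith [norm_sq_ofReal_sub_I t, norm_nonneg ((t : ℂ) - Complex.I), sq_nonneg t]

theorem abs_mul_norm_resolventFun_le (t : ℝ) : |t| * ‖resolventFun t‖ ≤ 1 := by
  rw [resolventFun, norm_inv, ← div_eq_mul_inv,
    div_le_one (norm_pos_iff.mpr (ofReal_sub_I_ne_zero t))]
  refine abs_le_of_sq_le_sq ?_ (norm_nonneg _)
  rw [norm_sq_ofReal_sub_I]
  linarith

theorem ofReal_mul_resolventFun (t : ℝ) :
    (t : ℂ) * resolventFun t = 1 + Complex.I * resolventFun t := by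
  have h := ofReal_sub_I_ne_zero t
  rw [resolventFun]
  field_simp
  ring

namespace IsSpectralMeasureOf

variable {E E' : ProjValuedMeasure H} {T : H →ₗ.[ℂ] H}

/-- The density formula reduces the domain condition to `|t (t - i)⁻¹| ≤ 1`. -/
theorem resolvent_mem (hE : E.IsSpectralMeasureOf T) (x : H) :
    E.integral resolventFun x ∈ T.domain := by
  rw [hE.1, E.vectorMeasure_integral continuous_resolventFun.stronglyMeasurable
    norm_resolventFun_le, lintegral_withDensity_eq_lintegral_mul _
    (continuous_resolventFun.norm.measurable.pow_const 2).ennreal_ofReal (by fun_prop)]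
  refine lt_of_le_of_lt (lintegral_mono (g := fun _ => 1) fun t => ?_) ?_
  · simp only [Pi.mul_apply]
    rw [← ENNReal.ofReal_mul (by positivity), ← sq_abs t, ← mul_pow, ← ENNReal.ofReal_one]
    refine ENNReal.ofReal_le_ofReal (pow_le_one₀ (by positivity) ?_)
    rw [mul_comm]
    exact abs_mul_norm_resolventFun_le t
  · rw [lintegral_const]
    exact ENNReal.mul_lt_top ENNReal.one_lt_top (measure_lt_top _ _)

theorem apply_resolvent (hE : E.IsSpectralMeasureOf T) (x : H) :
    T ⟨E.integral resolventFun x, hE.resolvent_mem x⟩ =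
      x + Complex.I • E.integral resolventFun x := by
  rw [← sub_eq_zero]
  refine hE.eq_zero_of_orthogonal fun v => ?_
  rw [inner_sub_right, sub_eq_zero]
  have hr := continuous_resolventFun.stronglyMeasurable
  -- Both sides are weak limits of `∫ 1_{[-n,n]}(t) t (t - i)⁻¹ dE`, and `t (t - i)⁻¹ = 1 + i (t -
  -- i)⁻¹`.
  refine tendsto_nhds_unique (hE.tendsto_inner v ⟨_, hE.resolvent_mem x⟩) ?_
  have h := E.tendsto_inner_integral (G := fun n t => cutoffId n t * resolventFun t)
    (g := fun t => (t : ℂ) * resolventFun t)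
    (Complex.continuous_ofReal.stronglyMeasurable.mul hr)
    (fun n => (stronglyMeasurable_cutoffId n).mul hr) (C := 1)
    (fun n t => by
      rw [norm_mul]
      exact (mul_le_mul_of_nonneg_right (norm_cutoffId_le_abs n t) (norm_nonneg _)).trans
        (abs_mul_norm_resolventFun_le t))
    (fun t => (tendsto_cutoffId t).mul_const _) (v : H) x
  have e1 : ∀ n, E.integral (fun t => cutoffId n t * resolventFun t) x =
      E.integral (cutoffId n) (E.integral resolventFun x) := fun n => by
    rw [E.integral_mul (stronglyMeasurable_cutoffId n) hr (norm_cutoffId_le n)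
      norm_resolventFun_le]
    rfl
  have e2 : E.integral (fun t : ℝ => (t : ℂ) * resolventFun t) x =
      x + Complex.I • E.integral resolventFun x := by
    have h1 := E.integral_add (g := fun _ => 1) (h := fun t => Complex.I * resolventFun t)
      (C := 1) (D := 1) stronglyMeasurable_const (stronglyMeasurable_const.mul hr) (by simp)
      (fun t => by simpa using norm_resolventFun_le t)
    have h2 := E.integral_mul (g := fun _ => Complex.I) (C := 1) stronglyMeasurable_const hr
      (by simp) norm_resolventFun_le
    rw [h2, E.integral_const, E.integral_const] at h1
    rw [show (fun t : ℝ => (t : ℂ) * resolventFun t) =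
        (fun _ => 1) + fun t => Complex.I * resolventFun t from funext ofReal_mul_resolventFun, h1]
    simp
  simpa only [e1, e2] using h

/-- `⟪w, T w⟫` is real as the integral of `t`, whereas `T w = i w` would make it `i ‖w‖²`. Hence `T
- i` is injective and the resolvent depends on `T` alone. -/
theorem eq_zero_of_apply_eq (hE : E.IsSpectralMeasureOf T) (w : T.domain)
    (hw : T w = Complex.I • (w : H)) : w = 0 := by
  have h := hE.2 w
  rw [hw, inner_smul_right, inner_self_eq_norm_sq_to_K, integral_complex_ofReal] at h
  have := congrArg Complex.im h
  norm_cast at this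
  simpa [← Complex.ofReal_pow] using this

theorem integral_resolventFun_eq (hE : E.IsSpectralMeasureOf T)
    (hE' : E'.IsSpectralMeasureOf T) : E.integral resolventFun = E'.integral resolventFun := by
  ext x
  have h := hE.eq_zero_of_apply_eq (⟨_, hE.resolvent_mem x⟩ - ⟨_, hE'.resolvent_mem x⟩) (by
    rw [LinearPMap.map_sub, hE.apply_resolvent, hE'.apply_resolvent, Submodule.coe_sub,
      smul_sub]
    abel)
  exact congrArg Subtype.val (sub_eq_zero.mp h)

/-- The bounded continuous functions on which two functional calculi agree. -/
noncomputable def agreeSubalgebra (E E' : ProjValuedMeasure H) :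
    StarSubalgebra ℂ (BoundedContinuousFunction ℝ ℂ) where
  carrier := {g | E.integral g = E'.integral g}
  mul_mem' := by
    intro g h hg hh
    have hm := fun k : BoundedContinuousFunction ℝ ℂ => k.continuous.stronglyMeasurable
    change E.integral (fun t => g t * h t) = E'.integral (fun t => g t * h t)
    rw [E.integral_mul (hm g) (hm h) g.norm_coe_le_norm h.norm_coe_le_norm,
      E'.integral_mul (hm g) (hm h) g.norm_coe_le_norm h.norm_coe_le_norm, hg, hh]
  add_mem' := by
    intro g h hg hh
    have hm := fun k : BoundedContinuousFunction ℝ ℂ => k.continuous.stronglyMeasurable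
    change E.integral (⇑g + ⇑h) = E'.integral (⇑g + ⇑h)
    rw [E.integral_add (hm g) (hm h) g.norm_coe_le_norm h.norm_coe_le_norm,
      E'.integral_add (hm g) (hm h) g.norm_coe_le_norm h.norm_coe_le_norm, hg, hh]
  algebraMap_mem' := by
    intro c
    change E.integral (fun _ => c) = E'.integral (fun _ => c)
    rw [E.integral_const, E'.integral_const]
  star_mem' := by
    intro g hg
    have hm := fun k : BoundedContinuousFunction ℝ ℂ => k.continuous.stronglyMeasurable
    change E.integral (fun t => (starRingEnd ℂ) (g t)) = E'.integral _
    rw [E.integral_conj (hm g) g.norm_coe_le_norm, hg,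
      ← E'.integral_conj (hm g) g.norm_coe_le_norm]
    rfl

/-- A self-adjoint operator has at most one spectral measure. -/
theorem unique (hE : E.IsSpectralMeasureOf T) (hE' : E'.IsSpectralMeasureOf T) : E = E' := by
  refine ext_of_vectorMeasure fun x => ?_
  -- A star subalgebra of bounded continuous functions that separates points determines a finite
  -- Borel measure on `ℝ`; the injective function `resolventFun` already separates them.
  refine ext_of_forall_mem_subalgebra_integral_eq_of_polish (𝕜 := ℂ)
    (A := agreeSubalgebra E E') ?_ ?_
  · intro s t hst
    let r : BoundedContinuousFunction ℝ ℂ :=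
      .ofNormedAddCommGroup resolventFun continuous_resolventFun 1 norm_resolventFun_le
    refine ⟨resolventFun, ⟨r.toContinuousMap, ⟨r, hE.integral_resolventFun_eq hE', rfl⟩, rfl⟩,
      fun h => hst ?_⟩
    simpa [resolventFun] using h
  · intro g hg
    have hm := g.continuous.stronglyMeasurable
    rw [← E.integral_spec hm g.norm_coe_le_norm, ← E'.integral_spec hm g.norm_coe_le_norm]
    rw [show E.integral g = E'.integral g from hg]

end IsSpectralMeasureOf

end ProjValuedMeasure

/-! ### Bounded multiplication operators and Fourier multipliers on `L²(ℝ, ℂ)` -/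

/-- `g` is Borel measurable and bounded. -/
def BoundedBorel (g : ℝ → ℂ) : Prop := StronglyMeasurable g ∧ ∃ C : ℝ, ∀ t, ‖g t‖ ≤ C

theorem BoundedBorel.comp {g : ℝ → ℂ} (hg : BoundedBorel g) {l : ℝ → ℝ} (hl : Measurable l) :
    BoundedBorel (g ∘ l) :=
  ⟨hg.1.comp_measurable hl, hg.2.imp fun _ h t => h (l t)⟩

theorem boundedBorel_indicator {s : Set ℝ} (hs : MeasurableSet s) :
    BoundedBorel (s.indicator fun _ => 1) :=
  ⟨stronglyMeasurable_const.indicator hs, 1, fun _ =>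
    (norm_indicator_le_norm_self _ _).trans (by simp)⟩

theorem memLp_mul {g : ℝ → ℂ} (hg : BoundedBorel g) (u : L2R) :
    MemLp (fun t => g t * u t) 2 volume := by
  obtain ⟨C, hC⟩ := hg.2
  refine (Lp.memLp u).of_le_mul (c := C) (hg.1.aestronglyMeasurable.mul
    (Lp.aestronglyMeasurable u)) (.of_forall fun t => ?_)
  rw [norm_mul]
  exact mul_le_mul_of_nonneg_right (hC t) (norm_nonneg _)

/-- Multiplication by a bounded Borel function as a bounded operator on `L²`. -/
noncomputable def boundedMul (g : ℝ → ℂ) (hg : BoundedBorel g) : L2R →L[ℂ] L2R :=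
  LinearMap.mkContinuousOfExistsBound
    { toFun := fun u => (memLp_mul hg u).toLp
      map_add' := fun u v => by
        rw [← MemLp.toLp_add, MemLp.toLp_eq_toLp_iff]
        filter_upwards [Lp.coeFn_add u v] with t h
        rw [h]; simp [mul_add]
      map_smul' := fun c u => by
        rw [RingHom.id_apply, ← MemLp.toLp_const_smul, MemLp.toLp_eq_toLp_iff]
        filter_upwards [Lp.coeFn_smul c u] with t h
        rw [h]; simp only [Pi.smul_apply, smul_eq_mul]; ring }
    (by
      obtain ⟨C, hC⟩ := hg.2
      refine ⟨C, fun u => Lp.norm_le_mul_norm_of_ae_le_mul ?_⟩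
      filter_upwards [(memLp_mul hg u).coeFn_toLp] with t h
      change ‖((memLp_mul hg u).toLp : ℝ → ℂ) t‖ ≤ _
      rw [h, norm_mul]
      exact mul_le_mul_of_nonneg_right (hC t) (norm_nonneg _))

theorem coeFn_boundedMul {g : ℝ → ℂ} (hg : BoundedBorel g) (u : L2R) :
    boundedMul g hg u =ᵐ[volume] fun t => g t * u t :=
  (memLp_mul hg u).coeFn_toLp

theorem inner_boundedMul {g : ℝ → ℂ} (hg : BoundedBorel g) (u v : L2R) :
    ⟪u, boundedMul g hg v⟫_ℂ = ∫ t, g t * ((starRingEnd ℂ) (u t) * v t) := by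
  rw [L2.inner_def]
  refine integral_congr_ae ?_
  filter_upwards [coeFn_boundedMul hg v] with t h
  rw [h, RCLike.inner_apply]
  ring

theorem norm_sq_eq_integral (u : L2R) : ‖u‖ ^ 2 = ∫ t, ‖u t‖ ^ 2 := by
  have h : ⟪u, u⟫_ℂ = ∫ t, ((‖u t‖ ^ 2 : ℝ) : ℂ) := by
    rw [L2.inner_def]
    refine integral_congr_ae (.of_forall fun t => ?_)
    simp only [inner_self_eq_norm_sq_to_K]
    simp
  rw [integral_complex_ofReal, inner_self_eq_norm_sq_to_K] at h
  refine Complex.ofReal_injective ?_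
  rw [← h]
  simp

theorem integrable_norm_sq (u : L2R) : Integrable fun t => ‖u t‖ ^ 2 :=
  (memLp_two_iff_integrable_sq_norm (Lp.aestronglyMeasurable u)).mp (Lp.memLp u)

theorem ofReal_norm_sq (u : L2R) :
    ENNReal.ofReal (‖u‖ ^ 2) = ∫⁻ t, ENNReal.ofReal (‖u t‖ ^ 2) := by
  rw [norm_sq_eq_integral, ofReal_integral_eq_lintegral_ofReal (integrable_norm_sq u)
    (.of_forall fun _ => sq_nonneg _)]

/-- Dominated convergence with majorant `(2C)² |u|²`. A general filter is allowed because
unconditional summation runs along finite subsets of `ℕ`, not along a sequence. -/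
theorem tendsto_boundedMul {ι : Type*} {l : Filter ι} [l.IsCountablyGenerated]
    {G : ι → ℝ → ℂ} {g : ℝ → ℂ} (hG : ∀ i, BoundedBorel (G i)) (hg : BoundedBorel g) {C : ℝ}
    (hC : ∀ i t, ‖G i t‖ ≤ C) (hCg : ∀ t, ‖g t‖ ≤ C)
    (hlim : ∀ t, Tendsto (fun i => G i t) l (𝓝 (g t))) (u : L2R) :
    Tendsto (fun i => boundedMul (G i) (hG i) u) l (𝓝 (boundedMul g hg u)) := by
  rw [tendsto_iff_norm_sub_tendsto_zero]
  have h1 : ∀ i, ‖boundedMul (G i) (hG i) u - boundedMul g hg u‖ ^ 2 =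
      ∫ t, ‖G i t - g t‖ ^ 2 * ‖u t‖ ^ 2 := by
    intro i
    rw [norm_sq_eq_integral]
    refine integral_congr_ae ?_
    filter_upwards [coeFn_boundedMul (hG i) u, coeFn_boundedMul hg u,
      Lp.coeFn_sub (boundedMul (G i) (hG i) u) (boundedMul g hg u)] with t h1 h2 h3
    rw [h3, Pi.sub_apply, h1, h2, ← sub_mul, norm_mul, mul_pow]
  have h2 : Tendsto (fun i => ∫ t, ‖G i t - g t‖ ^ 2 * ‖u t‖ ^ 2) l (𝓝 (∫ _ : ℝ, (0 : ℝ))) := by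
    refine tendsto_integral_filter_of_dominated_convergence
      (fun t => (C + C) ^ 2 * ‖u t‖ ^ 2) (.of_forall fun i => ?_)
      (.of_forall fun i => .of_forall fun t => ?_) ((integrable_norm_sq u).const_mul _)
      (.of_forall fun t => ?_)
    · exact (((hG i).1.sub hg.1).norm.pow 2).aestronglyMeasurable.mul
        (integrable_norm_sq u).aestronglyMeasurable
    · rw [norm_mul, norm_pow, norm_pow, norm_norm, norm_norm]
      gcongr
      exact (norm_sub_le _ _).trans (add_le_add (hC i t) (hCg t))
    · have := (((hlim t).sub_const (g t)).norm.pow 2).mul_const (‖u t‖ ^ 2)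
      simpa using this
  rw [integral_zero] at h2
  simp only [← h1] at h2
  have h3 := (Real.continuous_sqrt.tendsto 0).comp h2
  rw [Real.sqrt_zero] at h3
  refine h3.congr fun i => ?_
  simp [Real.sqrt_sq (norm_nonneg _)]

/-- The Fourier transform on `L²(ℝ, ℂ)`. -/
noncomputable abbrev fourierL2 : L2R ≃ₗᵢ[ℂ] L2R := Lp.fourierTransformₗᵢ ℝ ℂ

/-- The Fourier multiplier with a bounded Borel symbol. -/
noncomputable def fourierMul (g : ℝ → ℂ) (hg : BoundedBorel g) : L2R →L[ℂ] L2R :=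
  (fourierL2.symm.toContinuousLinearEquiv : L2R →L[ℂ] L2R) ∘L boundedMul g hg ∘L
    (fourierL2.toContinuousLinearEquiv : L2R →L[ℂ] L2R)

theorem fourierMul_apply {g : ℝ → ℂ} (hg : BoundedBorel g) (u : L2R) :
    fourierMul g hg u = fourierL2.symm (boundedMul g hg (fourierL2 u)) := rfl

theorem fourierL2_fourierMul {g : ℝ → ℂ} (hg : BoundedBorel g) (u : L2R) :
    fourierL2 (fourierMul g hg u) = boundedMul g hg (fourierL2 u) := by
  rw [fourierMul_apply, LinearIsometryEquiv.apply_symm_apply]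

theorem inner_fourierMul {g : ℝ → ℂ} (hg : BoundedBorel g) (u v : L2R) :
    ⟪u, fourierMul g hg v⟫_ℂ =
      ∫ t, g t * ((starRingEnd ℂ) (fourierL2 u t) * fourierL2 v t) := by
  rw [← inner_boundedMul, ← fourierL2_fourierMul, LinearIsometryEquiv.inner_map_map]

/-! ### The spectral measure of a Fourier multiplier -/

theorem inner_self_fourierMul {g : ℝ → ℂ} (hg : BoundedBorel g) (u : L2R) :
    ⟪u, fourierMul g hg u⟫_ℂ = ∫ t, g t * (‖fourierL2 u t‖ ^ 2 : ℝ) := by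
  rw [inner_fourierMul]
  refine integral_congr_ae (.of_forall fun t => ?_)
  simp only [Complex.conj_mul']
  push_cast
  rfl

theorem isStarProjection_fourierMul_indicator {s : Set ℝ} (hs : MeasurableSet s) :
    IsStarProjection (fourierMul (s.indicator fun _ => 1) (boundedBorel_indicator hs)) := by
  refine ⟨?_, ?_⟩
  · refine ProjValuedMeasure.clm_ext_of_inner_self fun x => ?_
    change ⟪x, fourierMul _ _ (fourierMul _ _ x)⟫_ℂ = _
    rw [inner_fourierMul, inner_fourierMul, fourierL2_fourierMul]
    refine integral_congr_ae ?_
    filter_upwards [coeFn_boundedMul (boundedBorel_indicator hs) (fourierL2 x)] with t h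
    rw [h]
    by_cases ht : t ∈ s <;> simp [ht]
  · rw [ContinuousLinearMap.isSelfAdjoint_iff_isSymmetric]
    intro x y
    change ⟪fourierMul _ _ x, y⟫_ℂ = ⟪x, fourierMul _ _ y⟫_ℂ
    rw [← inner_conj_symm, inner_fourierMul, inner_fourierMul, ← integral_conj]
    refine integral_congr_ae (.of_forall fun t => ?_)
    by_cases ht : t ∈ s <;> simp [ht, mul_comm]

theorem fourierMul_indicator_univ :
    fourierMul (Set.univ.indicator fun _ => 1) (boundedBorel_indicator MeasurableSet.univ) = 1 := by
  refine ProjValuedMeasure.clm_ext_of_inner_self fun x => ?_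
  change _ = ⟪x, x⟫_ℂ
  rw [inner_fourierMul, ← LinearIsometryEquiv.inner_map_map fourierL2 x x, L2.inner_def]
  refine integral_congr_ae (.of_forall fun t => ?_)
  simp [Complex.conj_mul']

theorem sum_boundedMul_indicator {s : ℕ → Set ℝ} (hs : ∀ i, MeasurableSet (s i))
    (hd : ∀ i j, i ≠ j → Disjoint (s i) (s j)) (u : L2R) (S : Finset ℕ) :
    ∑ i ∈ S, boundedMul ((s i).indicator fun _ => 1) (boundedBorel_indicator (hs i)) u =
      boundedMul ((⋃ i ∈ S, s i).indicator fun _ => 1)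
        (boundedBorel_indicator (S.measurableSet_biUnion fun i _ => hs i)) u := by
  induction S using Finset.induction_on with
  | empty =>
    refine Lp.ext ?_
    refine EventuallyEq.trans ?_ (coeFn_boundedMul _ u).symm
    rw [Finset.sum_empty]
    filter_upwards [Lp.coeFn_zero ℂ 2 (volume : Measure ℝ)] with t h2
    rw [h2]
    simp
  | insert a S ha ih =>
    rw [Finset.sum_insert ha, ih]
    refine Lp.ext ?_
    refine EventuallyEq.trans ?_ (coeFn_boundedMul _ u).symm
    refine (Lp.coeFn_add _ _).trans ?_
    filter_upwards [coeFn_boundedMul (boundedBorel_indicator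
        (S.measurableSet_biUnion fun i _ => hs i)) u,
      coeFn_boundedMul (boundedBorel_indicator (hs a)) u] with t h2 h3
    rw [Pi.add_apply, h2, h3]
    by_cases hta : t ∈ s a
    · have : ¬ ∃ i ∈ S, t ∈ s i := fun ⟨i, hi, hti⟩ =>
        Set.disjoint_left.mp (hd a i fun h => ha (h ▸ hi)) hta hti
      simp [Set.indicator, hta, this]
    · have h5 : t ∈ ⋃ i ∈ insert a S, s i ↔ t ∈ ⋃ i ∈ S, s i := by simp [hta]
      rw [Set.indicator_of_notMem hta, zero_mul, zero_add]
      by_cases ht : t ∈ ⋃ i ∈ S, s i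
      · rw [Set.indicator_of_mem ht, Set.indicator_of_mem (h5.mpr ht)]
      · rw [Set.indicator_of_notMem ht, Set.indicator_of_notMem (mt h5.mp ht)]

theorem hasSum_boundedMul_indicator {s : ℕ → Set ℝ} (hs : ∀ i, MeasurableSet (s i))
    (hd : ∀ i j, i ≠ j → Disjoint (s i) (s j)) (u : L2R) :
    HasSum (fun i => boundedMul ((s i).indicator fun _ => 1) (boundedBorel_indicator (hs i)) u)
      (boundedMul ((⋃ i, s i).indicator fun _ => 1)
        (boundedBorel_indicator (MeasurableSet.iUnion hs)) u) := by
  rw [HasSum, SummationFilter.unconditional_filter]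
  refine Tendsto.congr (fun S => (sum_boundedMul_indicator hs hd u S).symm) ?_
  refine tendsto_boundedMul _ _ (C := 1) (fun S t =>
    (norm_indicator_le_norm_self _ _).trans (by simp)) (fun t =>
    (norm_indicator_le_norm_self _ _).trans (by simp)) (fun t => ?_) _
  refine tendsto_const_nhds.congr' ?_
  by_cases ht : ∃ i, t ∈ s i
  · obtain ⟨i, hi⟩ := ht
    filter_upwards [eventually_ge_atTop {i}] with S hS
    have h1 : t ∈ ⋃ i, s i := Set.mem_iUnion.mpr ⟨i, hi⟩
    have h2 : t ∈ ⋃ i ∈ S, s i := Set.mem_biUnion (Finset.singleton_subset_iff.mp hS) hi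
    rw [Set.indicator_of_mem h1, Set.indicator_of_mem h2]
  · refine .of_forall fun S => ?_
    push Not at ht
    simp [Set.indicator, ht]

open scoped Classical in
/-- The projections `F⁻¹ 1_{l ∈ s} F`, for a Borel function `l` and a Borel set `s`. -/
noncomputable def fourierProj (l : ℝ → ℝ) (hl : Measurable l) (s : Set ℝ) : L2R →L[ℂ] L2R :=
  if hs : MeasurableSet s then
    fourierMul ((l ⁻¹' s).indicator fun _ => 1) (boundedBorel_indicator (hl hs)) else 0

theorem fourierProj_of_measurable {l : ℝ → ℝ} (hl : Measurable l) {s : Set ℝ}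
    (hs : MeasurableSet s) : fourierProj l hl s =
      fourierMul ((l ⁻¹' s).indicator fun _ => 1) (boundedBorel_indicator (hl hs)) :=
  dif_pos hs

/-- The projection-valued measure `s ↦ F⁻¹ 1_{l ∈ s} F`, for a Borel function `l`. -/
noncomputable def fourierPVM (l : ℝ → ℝ) (hl : Measurable l) : ProjValuedMeasure L2R where
  proj := fourierProj l hl
  isStarProjection s hs := by
    rw [fourierProj_of_measurable hl hs]
    exact isStarProjection_fourierMul_indicator (hl hs)
  not_measurable s hs := dif_neg hs
  proj_univ := by
    rw [fourierProj_of_measurable hl MeasurableSet.univ]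
    exact fourierMul_indicator_univ
  hasSum_iUnion s hs hd x := by
    rw [fourierProj_of_measurable hl (MeasurableSet.iUnion hs)]
    simp only [fun i => fourierProj_of_measurable hl (hs i)]
    have h := (hasSum_boundedMul_indicator (fun i => hl (hs i))
      (fun i j hij => (hd i j hij).preimage l) (fourierL2 x)).mapL
      (fourierL2.symm.toContinuousLinearEquiv : L2R →L[ℂ] L2R)
    simp only [← Set.preimage_iUnion] at h
    exact h

theorem fourierPVM_proj {l : ℝ → ℝ} (hl : Measurable l) {s : Set ℝ} (hs : MeasurableSet s) :
    (fourierPVM l hl).proj s =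
      fourierMul ((l ⁻¹' s).indicator fun _ => 1) (boundedBorel_indicator (hl hs)) :=
  fourierProj_of_measurable hl hs

/-- By Plancherel the vector measure is the image under `l` of the density `|û|²`, so integrals
against it become Lebesgue integrals on the Fourier side. -/
theorem fourierPVM_vectorMeasure {l : ℝ → ℝ} (hl : Measurable l) (x : L2R) :
    (fourierPVM l hl).vectorMeasure x =
      (volume.withDensity fun t => ENNReal.ofReal (‖fourierL2 x t‖ ^ 2)).map l := by
  ext s hs
  rw [ProjValuedMeasure.vectorMeasure_apply _ _ hs, Measure.map_apply hl hs,
    withDensity_apply _ (hl hs), fourierPVM_proj hl hs, ← LinearIsometryEquiv.norm_map fourierL2,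
    fourierL2_fourierMul, ofReal_norm_sq, ← lintegral_indicator (hl hs)]
  refine lintegral_congr_ae ?_
  filter_upwards [coeFn_boundedMul (boundedBorel_indicator (hl hs)) (fourierL2 x)] with t h
  rw [h]
  by_cases ht : t ∈ l ⁻¹' s
  · rw [Set.indicator_of_mem ht, Set.indicator_of_mem ht, one_mul]
  · rw [Set.indicator_of_notMem ht, Set.indicator_of_notMem ht]
    simp

theorem aemeasurable_norm_sq (u : L2R) :
    AEMeasurable (fun t => ENNReal.ofReal (‖u t‖ ^ 2)) volume :=
  ((integrable_norm_sq u).aestronglyMeasurable.aemeasurable).ennreal_ofReal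

theorem fourierPVM_integral_vectorMeasure {l : ℝ → ℝ} (hl : Measurable l) (x : L2R) {g : ℝ → ℂ}
    (hg : StronglyMeasurable g) :
    ∫ t, g t ∂((fourierPVM l hl).vectorMeasure x) =
      ∫ t, g (l t) * (‖fourierL2 x t‖ ^ 2 : ℝ) := by
  rw [fourierPVM_vectorMeasure, MeasureTheory.integral_map hl.aemeasurable hg.aestronglyMeasurable,
    integral_withDensity_eq_integral_toReal_smul₀ (aemeasurable_norm_sq _)
    (.of_forall fun _ => ENNReal.ofReal_lt_top)]
  refine integral_congr_ae (.of_forall fun t => ?_)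
  simp only [ENNReal.toReal_ofReal (sq_nonneg _), Complex.real_smul]
  ring

theorem fourierPVM_integral {l : ℝ → ℝ} (hl : Measurable l) {g : ℝ → ℂ} (hg : BoundedBorel g) :
    (fourierPVM l hl).integral g = fourierMul (g ∘ l) (hg.comp hl) :=
  ProjValuedMeasure.integral_unique _ fun x => by
    rw [inner_self_fourierMul, fourierPVM_integral_vectorMeasure hl x hg.1]
    rfl

theorem lintegral_fourierPVM_vectorMeasure {l : ℝ → ℝ} (hl : Measurable l) (x : L2R)
    {g : ℝ → ℝ≥0∞} (hg : Measurable g) :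
    ∫⁻ t, g t ∂((fourierPVM l hl).vectorMeasure x) =
      ∫⁻ t, ENNReal.ofReal (‖fourierL2 x t‖ ^ 2) * g (l t) := by
  rw [fourierPVM_vectorMeasure, lintegral_map hg hl,
    lintegral_withDensity_eq_lintegral_mul₀ (aemeasurable_norm_sq _)
    (g := fun t => g (l t)) (hg.comp hl).aemeasurable]
  rfl

/-! ### Density of the range of `p - i` -/

theorem exists_compactSupport_primitive {σ : ℝ → ℂ} (hσ : ContDiff ℝ ∞ σ)
    (hc : HasCompactSupport σ) (h0 : ∫ t, σ t = 0) :
    ∃ ψ : ℝ → ℂ, ContDiff ℝ ∞ ψ ∧ HasCompactSupport ψ ∧ ∀ x, HasDerivAt ψ (σ x) x := by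
  obtain ⟨R, hR⟩ := hc.isBounded.subset_ball 0
  have hsupp : ∀ t, t ∉ Set.Ioo (-R) R → σ t = 0 := fun t ht => by
    by_contra h
    have := hR (subset_tsupport σ h)
    rw [Real.ball_eq_Ioo, zero_sub, zero_add] at this
    exact ht this
  have hd : ∀ x, HasDerivAt (fun u => ∫ t in (-R)..u, σ t) (σ x) x := fun x =>
    intervalIntegral.integral_hasDerivAt_right (hσ.continuous.intervalIntegrable _ _)
      hσ.continuous.stronglyMeasurable.stronglyMeasurableAtFilter hσ.continuous.continuousAt
  refine ⟨fun u => ∫ t in (-R)..u, σ t, ?_, ?_, hd⟩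
  · rw [contDiff_infty_iff_deriv]
    refine ⟨fun x => (hd x).differentiableAt, ?_⟩
    rwa [funext fun x => (hd x).deriv]
  -- Left of `-R` the integrand vanishes; right of `R` the primitive is the total integral, which is
  -- zero by `h0`.
  · refine HasCompactSupport.intro (isCompact_Icc (a := -R) (b := R)) fun x hx => ?_
    rcases lt_or_ge x (-R) with h | h
    · have : ∫ t in (-R)..x, σ t = ∫ t in (-R)..x, (0 : ℂ) := by
        refine intervalIntegral.integral_congr fun t ht => hsupp t fun h' => ?_
        rw [Set.uIcc_of_ge h.le] at ht
        linarith [ht.2, h'.1]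
      simpa using this
    · have hxR : R < x := by
        by_contra h'
        exact hx ⟨h, not_lt.mp h'⟩
      change ∫ t in (-R)..x, σ t = 0
      rw [intervalIntegral.integral_eq_integral_of_support_subset, h0]
      intro t ht
      by_contra h'
      refine ht (hsupp t fun h'' => h' ⟨h''.1, by linarith [h''.2]⟩)

/-- A smooth compactly supported function as an element of `L²`. -/
noncomputable def smoothToL2 (φ : ℝ → ℂ) (h1 : ContDiff ℝ ∞ φ) (h2 : HasCompactSupport φ) : L2R :=
  (h1.continuous.memLp_of_hasCompactSupport h2).toLp φ

theorem coeFn_smoothToL2 {φ : ℝ → ℂ} (h1 : ContDiff ℝ ∞ φ) (h2 : HasCompactSupport φ) :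
    smoothToL2 φ h1 h2 =ᵐ[volume] φ :=
  MemLp.coeFn_toLp _

theorem norm_smoothToL2 {φ : ℝ → ℂ} (h1 : ContDiff ℝ ∞ φ) (h2 : HasCompactSupport φ) :
    ‖smoothToL2 φ h1 h2‖ = (eLpNorm φ 2 volume).toReal :=
  Lp.norm_toLp _ _

theorem eLpNorm_comp_add_right {φ : ℝ → ℂ} (h1 : Continuous φ) (a : ℝ) :
    eLpNorm (fun ξ => φ (ξ + a)) 2 volume = eLpNorm φ 2 volume :=
  eLpNorm_comp_measurePreserving (f := fun ξ => ξ + a) h1.aestronglyMeasurable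
    (measurePreserving_add_right volume a)

theorem contDiff_cexp_mul (K : ℝ) : ContDiff ℝ ∞ fun ξ : ℝ => (Real.exp (K * ξ) : ℂ) :=
  Complex.ofRealCLM.contDiff.comp (Real.contDiff_exp.comp (contDiff_const.mul contDiff_id))

/-- The equation `(i/K) φ' - i φ = χ` has the integrating factor `e^{-Kξ}`: `φ = e^{Kξ} ψ` with `ψ'
= -iK e^{-Kξ} χ`. The moment condition is what makes `ψ` compactly supported. -/
theorem smooth_mem_range_shift {K : ℝ} (hK : K ≠ 0) {χ : ℝ → ℂ} (h1 : ContDiff ℝ ∞ χ)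
    (h2 : HasCompactSupport χ) (h0 : ∫ ξ, (Real.exp (-K * ξ) : ℂ) * χ ξ = 0) {u : L2R}
    (hu : u =ᵐ[volume] χ) : ∃ w ∈ momentumGraph K, w.2 - Complex.I • w.1 = u := by
  have hK' : (K : ℂ) ≠ 0 := by exact_mod_cast hK
  obtain ⟨ψ, k1, k2, k3⟩ := exists_compactSupport_primitive
    (σ := fun ξ => (-Complex.I * K) * ((Real.exp (-K * ξ) : ℂ) * χ ξ))
    (contDiff_const.mul ((contDiff_cexp_mul (-K)).mul h1)) (h2.mul_left.mul_left)
    (by rw [integral_const_mul, h0, mul_zero])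
  set φ : ℝ → ℂ := fun ξ => (Real.exp (K * ξ) : ℂ) * ψ ξ with hφ
  have p1 : ContDiff ℝ ∞ φ := (contDiff_cexp_mul K).mul k1
  have p2 : HasCompactSupport φ := k2.mul_left
  have hder : ∀ ξ, deriv φ ξ = K * φ ξ + (-Complex.I * K) * χ ξ := by
    intro ξ
    have e1 : HasDerivAt (fun ξ : ℝ => (Real.exp (K * ξ) : ℂ)) (Real.exp (K * ξ) * K : ℝ) ξ := by
      refine HasDerivAt.ofReal_comp ?_
      simpa using ((hasDerivAt_id ξ).const_mul K).exp
    refine ((e1.mul (k3 ξ)).deriv).trans ?_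
    simp only [hφ]
    have e2 : (Real.exp (K * ξ) : ℂ) * (Real.exp (-K * ξ) : ℂ) = 1 := by
      rw [← Complex.ofReal_mul, ← Real.exp_add]
      simp
    push_cast at e2 ⊢
    linear_combination (-Complex.I * K * χ ξ) * e2
  have hdc : HasCompactSupport (deriv φ) := p2.deriv
  have hds : ContDiff ℝ ∞ (deriv φ) := (contDiff_infty_iff_deriv.mp p1).2
  refine ⟨(smoothToL2 φ p1 p2, (Complex.I / K) • smoothToL2 (deriv φ) hds hdc),
    ⟨φ, p1, p2, coeFn_smoothToL2 p1 p2, ?_⟩, ?_⟩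
  · filter_upwards [coeFn_smoothToL2 hds hdc,
      Lp.coeFn_smul (Complex.I / K : ℂ) (smoothToL2 (deriv φ) hds hdc)] with ξ a1 a2
    rw [a2, Pi.smul_apply, a1, smul_eq_mul]
  · refine Lp.ext ?_
    refine (Lp.coeFn_sub _ _).trans ?_
    filter_upwards [coeFn_smoothToL2 hds hdc, coeFn_smoothToL2 p1 p2, hu,
      Lp.coeFn_smul (Complex.I / K : ℂ) (smoothToL2 (deriv φ) hds hdc),
      Lp.coeFn_smul Complex.I (smoothToL2 φ p1 p2)] with ξ a1 a2 a3 a4 a5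
    rw [Pi.sub_apply, a4, a5, Pi.smul_apply, Pi.smul_apply, a1, a2, a3, hder, smul_eq_mul,
      smul_eq_mul]
    field_simp
    linear_combination (-χ ξ) * Complex.I_sq

/-- The moment condition can be enforced at arbitrarily small `L²` cost. Translating `η` to the left
by `n` keeps its norm but multiplies its moment against `e^{-Kξ}` by `e^{Kn}`, so a correction with
coefficient `d e^{-Kn}` suffices. -/
theorem dense_range_shift {K : ℝ} (hK : 0 < K) :
    Dense {u : L2R | ∃ w ∈ momentumGraph K, w.2 - Complex.I • w.1 = u} := by
  -- It is enough that every test function is a limit of elements of the range.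
  rw [← dense_closure]
  refine (Lp.dense_hasCompactSupport_contDiff (E := ℝ) (F := ℂ) (μ := volume) (p := 2)
    (by simp)).mono ?_
  rintro u ⟨χ, hu, h2, h1⟩
  let b : ContDiffBump (0 : ℝ) := ⟨1, 2, one_pos, one_lt_two⟩
  let β : ℝ → ℂ := fun ξ => (b.normed volume ξ : ℂ)
  have hβ1 : ContDiff ℝ ∞ β := Complex.ofRealCLM.contDiff.comp b.contDiff_normed
  have hβ2 : HasCompactSupport β := b.hasCompactSupport_normed.comp_left Complex.ofReal_zero
  have hβ0 : ∫ ξ, β ξ = 1 := by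
    have : ∫ ξ, β ξ = ((∫ ξ, b.normed volume ξ : ℝ) : ℂ) := integral_complex_ofReal
    rw [this, b.integral_normed, Complex.ofReal_one]
  set d : ℂ := ∫ ξ, (Real.exp (-K * ξ) : ℂ) * χ ξ with hd
  -- The factor `e^{Kξ}` cancels the weight, so that `η` has moment `∫ β = 1`.
  let η : ℝ → ℂ := fun ξ => (Real.exp (K * ξ) : ℂ) * β ξ
  have hη1 : ContDiff ℝ ∞ η := (contDiff_cexp_mul K).mul hβ1
  have hη2 : HasCompactSupport η := hβ2.mul_left
  have ht1 : ∀ n : ℕ, ContDiff ℝ ∞ fun ξ => η (ξ + n) :=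
    fun n => hη1.comp (contDiff_id.add contDiff_const)
  have ht2 : ∀ n : ℕ, HasCompactSupport fun ξ => η (ξ + n) :=
    fun n => hη2.comp_homeomorph (Homeomorph.addRight (n : ℝ))
  have hnorm : ∀ n : ℕ, ‖smoothToL2 _ (ht1 n) (ht2 n)‖ = ‖smoothToL2 η hη1 hη2‖ := by
    intro n
    rw [norm_smoothToL2, norm_smoothToL2, eLpNorm_comp_add_right hη1.continuous]
  let z : ℕ → L2R := fun n =>
    u - (d * (Real.exp (-(K * n)) : ℂ)) • smoothToL2 _ (ht1 n) (ht2 n)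
  have hz : Tendsto z atTop (𝓝 u) := by
    have : Tendsto (fun n : ℕ => (d * (Real.exp (-(K * n)) : ℂ)) • smoothToL2 _ (ht1 n) (ht2 n))
        atTop (𝓝 0) := by
      rw [tendsto_zero_iff_norm_tendsto_zero]
      simp only [norm_smul, norm_mul, hnorm, Complex.norm_real, Real.norm_eq_abs, Real.abs_exp]
      have e : Tendsto (fun n : ℕ => Real.exp (-(K * n))) atTop (𝓝 0) :=
        Real.tendsto_exp_neg_atTop_nhds_zero.comp
          (tendsto_natCast_atTop_atTop.const_mul_atTop hK)
      simpa using (e.const_mul ‖d‖).mul_const ‖smoothToL2 η hη1 hη2‖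
    simpa [z] using tendsto_const_nhds.sub this
  refine mem_closure_of_tendsto hz (.of_forall fun n => ?_)
  have hint : ∀ {χ : ℝ → ℂ}, ContDiff ℝ ∞ χ → HasCompactSupport χ →
      Integrable fun ξ => (Real.exp (-K * ξ) : ℂ) * χ ξ := fun k1 k2 =>
    ((contDiff_cexp_mul (-K)).continuous.mul k1.continuous).integrable_of_hasCompactSupport
      k2.mul_left
  refine smooth_mem_range_shift hK.ne'
    (χ := fun ξ => χ ξ - (d * (Real.exp (-(K * n)) : ℂ)) * η (ξ + n))
    (h1.sub (contDiff_const.mul (ht1 n))) (h2.sub ((ht2 n).mul_left)) ?_ ?_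
  · have e : ∀ ξ : ℝ, (Real.exp (-K * ξ) : ℂ) *
        (χ ξ - (d * (Real.exp (-(K * n)) : ℂ)) * η (ξ + n)) =
        (Real.exp (-K * ξ) : ℂ) * χ ξ - d * β (ξ + n) := by
      intro ξ
      have e2 : (Real.exp (-K * ξ) : ℂ) * (Real.exp (-(K * n)) : ℂ) *
          (Real.exp (K * (ξ + n)) : ℂ) = 1 := by
        rw [← Complex.ofReal_mul, ← Complex.ofReal_mul, ← Real.exp_add, ← Real.exp_add]
        ring_nf
        simp
      simp only [η]
      linear_combination (-d * β (ξ + n)) * e2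
    simp only [e]
    have hβi : Integrable β := hβ1.continuous.integrable_of_hasCompactSupport hβ2
    rw [integral_sub (hint h1 h2) ((hβi.comp_add_right (n : ℝ)).const_mul d), integral_const_mul,
      integral_add_right_eq_self β, hβ0, mul_one, ← hd, sub_self]
  · refine (Lp.coeFn_sub _ _).trans ?_
    filter_upwards [hu, coeFn_smoothToL2 (ht1 n) (ht2 n),
      Lp.coeFn_smul (d * (Real.exp (-(K * n)) : ℂ)) (smoothToL2 _ (ht1 n) (ht2 n))]
      with ξ a1 a2 a3
    rw [Pi.sub_apply, a3, Pi.smul_apply, a1, a2, smul_eq_mul]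

/-! ### The spectral measure of the momentum operator -/

theorem boundedBorel_resolventFun : BoundedBorel ProjValuedMeasure.resolventFun :=
  ⟨ProjValuedMeasure.continuous_resolventFun.stronglyMeasurable, 1,
    ProjValuedMeasure.norm_resolventFun_le⟩

/-- The graph of the Fourier multiplier with real Borel symbol `l`. -/
noncomputable def multiplierGraph (l : ℝ → ℝ) (hl : Measurable l) : Submodule ℂ (L2R × L2R) :=
  (ContinuousLinearMap.fst ℂ L2R L2R -
    fourierMul _ (boundedBorel_resolventFun.comp hl) ∘L
      (ContinuousLinearMap.snd ℂ L2R L2R - Complex.I • ContinuousLinearMap.fst ℂ L2R L2R)).ker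

theorem mem_multiplierGraph {l : ℝ → ℝ} (hl : Measurable l) {w : L2R × L2R} :
    w ∈ multiplierGraph l hl ↔
      w.1 = fourierMul _ (boundedBorel_resolventFun.comp hl) (w.2 - Complex.I • w.1) := by
  rw [multiplierGraph, LinearMap.mem_ker]
  exact sub_eq_zero

theorem isClosed_multiplierGraph {l : ℝ → ℝ} (hl : Measurable l) :
    IsClosed (multiplierGraph l hl : Set (L2R × L2R)) :=
  ContinuousLinearMap.isClosed_ker _

/-- Multiplication by `l(t) - i`, which never vanishes for real `l`, relates the resolvent form of
the graph, closed as a kernel, to the pointwise one. -/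
theorem mem_multiplierGraph_iff_ae {l : ℝ → ℝ} (hl : Measurable l) {w : L2R × L2R} :
    w ∈ multiplierGraph l hl ↔
      fourierL2 w.2 =ᵐ[volume] fun t => (l t : ℂ) * fourierL2 w.1 t := by
  have hg := boundedBorel_resolventFun.comp hl
  have e : (w ∈ multiplierGraph l hl) ↔ fourierL2 w.1 =ᵐ[volume]
      fun t => ProjValuedMeasure.resolventFun (l t) *
        (fourierL2 w.2 t - Complex.I * fourierL2 w.1 t) := by
    have e2 : boundedMul _ hg (fourierL2 (w.2 - Complex.I • w.1)) =ᵐ[volume]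
        fun t => ProjValuedMeasure.resolventFun (l t) *
        (fourierL2 w.2 t - Complex.I * fourierL2 w.1 t) := by
      refine (coeFn_boundedMul hg _).trans ?_
      rw [map_sub, map_smul]
      filter_upwards [Lp.coeFn_sub (fourierL2 w.2) (Complex.I • fourierL2 w.1),
        Lp.coeFn_smul Complex.I (fourierL2 w.1)] with t h1 h2
      rw [h1, Pi.sub_apply, h2]
      rfl
    rw [mem_multiplierGraph, ← fourierL2.injective.eq_iff, fourierL2_fourierMul]
    constructor
    · intro h
      nth_rw 1 [h]
      exact e2
    · intro h
      exact Lp.ext (h.trans e2.symm)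
  rw [e]
  constructor <;> intro h <;> filter_upwards [h] with t ht
  · have h0 := ProjValuedMeasure.ofReal_sub_I_ne_zero (l t)
    rw [ProjValuedMeasure.resolventFun, eq_inv_mul_iff_mul_eq₀ h0] at ht
    linear_combination -ht
  · have h0 := ProjValuedMeasure.ofReal_sub_I_ne_zero (l t)
    rw [ProjValuedMeasure.resolventFun, eq_inv_mul_iff_mul_eq₀ h0, ht]
    ring

/-- Test functions are Schwartz functions, on which the `L²` transform agrees with the Fourier
integral. -/
theorem fourierL2_of_smooth {φ : ℝ → ℂ} (h1 : ContDiff ℝ ∞ φ) (h2 : HasCompactSupport φ)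
    {u : L2R} (hu : u =ᵐ[volume] φ) :
    fourierL2 u =ᵐ[volume] FourierTransform.fourier φ := by
  let f : SchwartzMap ℝ ℂ := h2.toSchwartzMap h1
  have e : u = f.toLp 2 := Lp.ext (hu.trans (f.coeFn_toLp 2).symm)
  have h := SchwartzMap.toLp_fourier_eq f
  rw [e]
  change (FourierTransform.fourier (f.toLp 2 : L2R) : L2R) =ᵐ[volume] _
  rw [h]
  exact SchwartzMap.coeFn_toLp (FourierTransform.fourier f : SchwartzMap ℝ ℂ) 2 volume

/-- The symbol of the momentum operator. -/
noncomputable def momentumSymbol (K t : ℝ) : ℝ := -(2 * Real.pi / K * t)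

theorem measurable_momentumSymbol (K : ℝ) : Measurable (momentumSymbol K) :=
  (measurable_const.mul measurable_id).neg

theorem momentumGraph_le (K : ℝ) :
    momentumGraph K ≤ multiplierGraph _ (measurable_momentumSymbol K) := by
  rintro w ⟨φ, h1, h2, h3, h4⟩
  rw [mem_multiplierGraph_iff_ae]
  have hds : ContDiff ℝ ∞ (deriv φ) := (contDiff_infty_iff_deriv.mp h1).2
  have hF := Real.fourier_deriv (h1.continuous.integrable_of_hasCompactSupport h2)
    (h1.differentiable (by simp)) (hds.continuous.integrable_of_hasCompactSupport h2.deriv)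
  have e : w.2 = (Complex.I / K : ℂ) • smoothToL2 _ hds h2.deriv := by
    refine Lp.ext (h4.trans ?_)
    filter_upwards [Lp.coeFn_smul (Complex.I / K : ℂ) (smoothToL2 _ hds h2.deriv),
      coeFn_smoothToL2 hds h2.deriv] with t a1 a2
    rw [a1, Pi.smul_apply, a2, smul_eq_mul]
  rw [e, map_smul]
  filter_upwards [Lp.coeFn_smul (Complex.I / K : ℂ) (fourierL2 (smoothToL2 _ hds h2.deriv)),
    fourierL2_of_smooth hds h2.deriv (coeFn_smoothToL2 hds h2.deriv),
    fourierL2_of_smooth h1 h2 h3] with t a1 a2 a3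
  rw [a1, Pi.smul_apply, a2, a3, hF, momentumSymbol]
  simp only [smul_eq_mul]
  push_cast
  linear_combination (2 * Real.pi * t / K * FourierTransform.fourier φ t) * Complex.I_sq

/-- The graph of the multiplier is the image of `L²` under the continuous map `z ↦ (R z, z + i R
z)`, with `R` the resolvent. Values `z = (p - i) φ` are sent into the graph of `p`, and such `z` are
dense. -/
theorem topologicalClosure_momentumGraph {K : ℝ} (hK : 0 < K) :
    (momentumGraph K).topologicalClosure =
      multiplierGraph _ (measurable_momentumSymbol K) := by
  refine le_antisymm (Submodule.topologicalClosure_minimal _ (momentumGraph_le K)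
    (isClosed_multiplierGraph _)) fun w hw => ?_
  set R := fourierMul _ (boundedBorel_resolventFun.comp (measurable_momentumSymbol K)) with hR
  let Ψ : L2R → L2R × L2R := fun z => (R z, z + Complex.I • R z)
  have hΨ : Continuous Ψ := by fun_prop
  have key : ∀ v ∈ multiplierGraph _ (measurable_momentumSymbol K),
      Ψ (v.2 - Complex.I • v.1) = v := by
    intro v hv
    rw [mem_multiplierGraph, ← hR] at hv
    refine Prod.ext hv.symm ?_
    change v.2 - Complex.I • v.1 + Complex.I • R (v.2 - Complex.I • v.1) = v.2
    rw [← hv, sub_add_cancel]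
  rw [← SetLike.mem_coe, Submodule.topologicalClosure_coe, ← key w hw]
  refine map_mem_closure hΨ (dense_range_shift hK _) ?_
  rintro _ ⟨v, hv, rfl⟩
  rw [key v (momentumGraph_le K hv)]
  exact hv

theorem momentumBar_graph {K : ℝ} (hK : 0 < K) :
    (momentumBar K).graph = multiplierGraph _ (measurable_momentumSymbol K) := by
  -- Closability has to be proved because `LinearPMap.closure` returns a non-closable operator
  -- unchanged.
  have h : (momentum K).IsClosable := by
    refine ⟨(multiplierGraph _ (measurable_momentumSymbol K)).toLinearPMap, ?_⟩
    rw [momentum_graph, topologicalClosure_momentumGraph hK,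
      Submodule.toLinearPMap_graph_eq]
    intro w hw h0
    rw [mem_multiplierGraph_iff_ae, h0, map_zero] at hw
    rw [← fourierL2.map_eq_zero_iff]
    refine Lp.ext (hw.trans ?_)
    filter_upwards [Lp.coeFn_zero ℂ 2 (volume : Measure ℝ)] with t ht
    rw [ht]
    simp
  rw [momentumBar, ← h.graph_closure_eq_closure_graph, momentum_graph,
    topologicalClosure_momentumGraph hK]

theorem mem_momentumBar_domain {K : ℝ} (hK : 0 < K) (x : L2R) :
    x ∈ (momentumBar K).domain ↔
      MemLp (fun t => (momentumSymbol K t : ℂ) * fourierL2 x t) 2 volume := by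
  rw [LinearPMap.mem_domain_iff, momentumBar_graph hK]
  simp only [mem_multiplierGraph_iff_ae]
  constructor
  · rintro ⟨y, hy⟩
    exact (Lp.memLp _).ae_eq hy
  · intro h
    refine ⟨fourierL2.symm h.toLp, ?_⟩
    rw [LinearIsometryEquiv.apply_symm_apply]
    exact h.coeFn_toLp

theorem isSpectralMeasureOf_momentumBar {K : ℝ} (hK : 0 < K) :
    (fourierPVM _ (measurable_momentumSymbol K)).IsSpectralMeasureOf (momentumBar K) := by
  refine ⟨fun x => ?_, fun x => ?_⟩
  · rw [mem_momentumBar_domain hK, lintegral_fourierPVM_vectorMeasure _ _ (by fun_prop)]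
    have hm : AEStronglyMeasurable (fun t => (momentumSymbol K t : ℂ) * fourierL2 x t) volume :=
      (Complex.measurable_ofReal.comp
        (measurable_momentumSymbol K)).stronglyMeasurable.aestronglyMeasurable.mul
        (Lp.aestronglyMeasurable _)
    have hm2 : AEStronglyMeasurable
        (fun t => ‖(momentumSymbol K t : ℂ) * fourierL2 x t‖ ^ 2) volume := hm.norm.pow 2
    rw [memLp_two_iff_integrable_sq_norm hm, Integrable, and_iff_right hm2,
      hasFiniteIntegral_iff_ofReal (.of_forall fun t => sq_nonneg _)]
    have e : ∀ t, ENNReal.ofReal (‖(momentumSymbol K t : ℂ) * fourierL2 x t‖ ^ 2) =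
        ENNReal.ofReal (‖fourierL2 x t‖ ^ 2) * ENNReal.ofReal (momentumSymbol K t ^ 2) := by
      intro t
      rw [← ENNReal.ofReal_mul (sq_nonneg _), norm_mul, mul_pow, Complex.norm_real,
        Real.norm_eq_abs, sq_abs, mul_comm]
    simp only [e]
  · have hx : ((x : L2R), momentumBar K x) ∈ (momentumBar K).graph := LinearPMap.mem_graph _ x
    rw [momentumBar_graph hK, mem_multiplierGraph_iff_ae] at hx
    rw [fourierPVM_integral_vectorMeasure _ _ Complex.continuous_ofReal.stronglyMeasurable,
      ← LinearIsometryEquiv.inner_map_map fourierL2, L2.inner_def]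
    refine integral_congr_ae ?_
    filter_upwards [hx] with t ht
    rw [ht, RCLike.inner_apply, mul_assoc, Complex.mul_conj']
    push_cast
    rfl

theorem existsUnique_spectralMeasure_momentumBar {K : ℝ} (hK : 0 < K) :
    ∃! E : ProjValuedMeasure L2R, E.IsSpectralMeasureOf (momentumBar K) :=
  ⟨_, isSpectralMeasureOf_momentumBar hK, fun _ h =>
    h.unique (isSpectralMeasureOf_momentumBar hK)⟩

theorem borelFunctionalCalculus_momentumBar {K : ℝ} (hK : 0 < K) {g : ℝ → ℂ}
    (hg : BoundedBorel g) :
    borelFunctionalCalculus (momentumBar K) g =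
      fourierMul _ (hg.comp (measurable_momentumSymbol K)) := by
  have h : ∃ E : ProjValuedMeasure L2R, E.IsSpectralMeasureOf (momentumBar K) :=
    ⟨_, isSpectralMeasureOf_momentumBar hK⟩
  rw [borelFunctionalCalculus, dif_pos h,
    h.choose_spec.unique (isSpectralMeasureOf_momentumBar hK), fourierPVM_integral _ hg]

/-! ### Shifting the line of integration in a strip -/

/-- Cauchy's theorem on `[-T, T] × [a, b]`: the vertical sides are `O((1 + T²)⁻¹)` and vanish as `T
→ ∞`. -/
theorem integral_horizontal_eq_of_mem_Ioo {G : ℂ → ℂ} {C : ℝ}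
    (hG : DifferentiableOn ℂ G {z : ℂ | -1 < z.im ∧ z.im < 0})
    (hb : ∀ x y : ℝ, -1 < y → y < 0 → ‖G ⟨x, y⟩‖ ≤ C * (1 + x ^ 2)⁻¹) {a b : ℝ}
    (ha : a ∈ Set.Ioo (-1) 0) (hab : b ∈ Set.Ioo (-1) 0) :
    ∫ x : ℝ, G ⟨x, a⟩ = ∫ x : ℝ, G ⟨x, b⟩ := by
  have hmk : ∀ x y : ℝ, (x : ℂ) + y * Complex.I = ⟨x, y⟩ := fun x y => by
    apply Complex.ext <;> simp
  have hint : ∀ y ∈ Set.Ioo (-1 : ℝ) 0, Integrable fun x : ℝ => G ⟨x, y⟩ := by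
    intro y hy
    refine (integrable_inv_one_add_sq.const_mul C).mono' ?_ (.of_forall fun x => hb x y hy.1 hy.2)
    have : Continuous fun x : ℝ => G ⟨x, y⟩ := by
      refine hG.continuousOn.comp_continuous ?_ (fun x => ⟨hy.1, hy.2⟩)
      simp only [← hmk]
      fun_prop
    exact this.aestronglyMeasurable
  have hlim : ∀ y ∈ Set.Ioo (-1 : ℝ) 0, Tendsto (fun T : ℝ => ∫ x in (-T)..T, G ⟨x, y⟩) atTop
      (𝓝 (∫ x : ℝ, G ⟨x, y⟩)) := fun y hy =>
    intervalIntegral_tendsto_integral (hint y hy) tendsto_neg_atTop_atBot tendsto_id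
  have hsub : Set.uIcc a b ⊆ Set.Ioo (-1) 0 := (Set.ordConnected_Ioo).uIcc_subset ha hab
  have hvert : ∀ T : ℝ, ‖∫ y in a..b, G ⟨T, y⟩‖ ≤ C * (1 + T ^ 2)⁻¹ * |b - a| := fun T =>
    intervalIntegral.norm_integral_le_of_norm_le_const fun y hy => by
      have := hsub (Set.uIoc_subset_uIcc hy)
      exact hb T y this.1 this.2
  have hdecay : Tendsto (fun T : ℝ => C * (1 + T ^ 2)⁻¹ * |b - a|) atTop (𝓝 0) := by
    have h1 : Tendsto (fun T : ℝ => 1 + T ^ 2) atTop atTop :=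
      tendsto_atTop_add_const_left _ _ (tendsto_pow_atTop two_ne_zero)
    simpa using ((tendsto_inv_atTop_zero.comp h1).const_mul C).mul_const |b - a|
  have hv1 : Tendsto (fun T : ℝ => ∫ y in a..b, G ⟨T, y⟩) atTop (𝓝 0) :=
    squeeze_zero_norm hvert hdecay
  have hv2 : Tendsto (fun T : ℝ => ∫ y in a..b, G ⟨-T, y⟩) atTop (𝓝 0) :=
    squeeze_zero_norm (fun T => by simpa using hvert (-T)) hdecay
  have hrect : ∀ T : ℝ, (∫ x in (-T)..T, G ⟨x, a⟩) - (∫ x in (-T)..T, G ⟨x, b⟩) +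
      Complex.I • (∫ y in a..b, G ⟨T, y⟩) - Complex.I • (∫ y in a..b, G ⟨-T, y⟩) = 0 := by
    intro T
    have := Complex.integral_boundary_rect_eq_zero_of_differentiableOn G ⟨-T, a⟩ ⟨T, b⟩
      (hG.mono fun z hz => hsub hz.2)
    simpa only [hmk] using this
  have h := ((((hlim a ha).sub (hlim b hab)).add (hv1.const_smul Complex.I)).sub
    (hv2.const_smul Complex.I))
  simp only [hrect] at h
  have := tendsto_nhds_unique h tendsto_const_nhds
  simpa [sub_eq_zero] using this

/-- The integral over the upper boundary line of a strip equals that over the lower one. -/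
theorem integral_strip_boundary_eq {G : ℂ → ℂ} {C : ℝ}
    (hG : DifferentiableOn ℂ G {z : ℂ | -1 < z.im ∧ z.im < 0})
    (hb : ∀ x y : ℝ, -1 < y → y < 0 → ‖G ⟨x, y⟩‖ ≤ C * (1 + x ^ 2)⁻¹)
    (htop : ∀ᵐ x : ℝ, Tendsto (fun y : ℝ => G ⟨x, y⟩) (𝓝[<] 0) (𝓝 (G ⟨x, 0⟩)))
    (hbot : ∀ᵐ x : ℝ, Tendsto (fun y : ℝ => G ⟨x, y⟩) (𝓝[>] (-1)) (𝓝 (G ⟨x, -1⟩))) :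
    ∫ x : ℝ, G ⟨x, 0⟩ = ∫ x : ℝ, G ⟨x, -1⟩ := by
  have hmk : ∀ x y : ℝ, (x : ℂ) + y * Complex.I = ⟨x, y⟩ := fun x y => by
    apply Complex.ext <;> simp
  -- All lines in the open strip give the integral at the reference height `-1/2`. Dominated
  -- convergence carries this to a boundary line, where almost everywhere convergence is enough.
  have hmem : ∀ c : ℝ, ∀ l : Filter ℝ, l.IsCountablyGenerated →
      (∀ᶠ y in l, y ∈ Set.Ioo (-1 : ℝ) 0) →
      (∀ᵐ x : ℝ, Tendsto (fun y : ℝ => G ⟨x, y⟩) l (𝓝 (G ⟨x, c⟩))) →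
      Tendsto (fun _ : ℝ => ∫ x : ℝ, G ⟨x, -1/2⟩) l (𝓝 (∫ x : ℝ, G ⟨x, c⟩)) := by
    intro c l hl hev hlim
    have h1 : Tendsto (fun y : ℝ => ∫ x : ℝ, G ⟨x, y⟩) l (𝓝 (∫ x : ℝ, G ⟨x, c⟩)) := by
      refine tendsto_integral_filter_of_dominated_convergence (fun x => C * (1 + x ^ 2)⁻¹)
        ?_ ?_ (integrable_inv_one_add_sq.const_mul C) hlim
      · filter_upwards [hev] with y hy
        have : Continuous fun x : ℝ => G ⟨x, y⟩ := by
          refine hG.continuousOn.comp_continuous ?_ (fun x => ⟨hy.1, hy.2⟩)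
          simp only [← hmk]
          fun_prop
        exact this.aestronglyMeasurable
      · filter_upwards [hev] with y hy
        exact .of_forall fun x => hb x y hy.1 hy.2
    refine h1.congr' ?_
    filter_upwards [hev] with y hy
    exact integral_horizontal_eq_of_mem_Ioo hG hb hy (by norm_num)
  have h1 := hmem 0 (𝓝[<] 0) inferInstance (Ioo_mem_nhdsLT (by norm_num)) htop
  have h2 := hmem (-1) (𝓝[>] (-1)) inferInstance (Ioo_mem_nhdsGT (by norm_num)) hbot
  rw [tendsto_nhds_unique h1 tendsto_const_nhds, tendsto_nhds_unique h2 tendsto_const_nhds]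

/-! ### The Fourier-Laplace transform of test functions -/

/-- The entire function `z ↦ ∫ exp(i k z ξ) φ(ξ) dξ`. -/
noncomputable def laplaceFourier (k : ℝ) (φ : ℝ → ℂ) (z : ℂ) : ℂ :=
  ∫ ξ : ℝ, Complex.exp (Complex.I * k * z * ξ) * φ ξ

theorem integrable_laplaceFourier (k : ℝ) {φ : ℝ → ℂ} (h1 : Continuous φ)
    (h2 : HasCompactSupport φ) (z : ℂ) :
    Integrable fun ξ : ℝ => Complex.exp (Complex.I * k * z * ξ) * φ ξ := by
  refine Continuous.integrable_of_hasCompactSupport ?_ h2.mul_left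
  fun_prop

theorem differentiable_laplaceFourier (k : ℝ) {φ : ℝ → ℂ} (h1 : Continuous φ)
    (h2 : HasCompactSupport φ) : Differentiable ℂ (laplaceFourier k φ) := by
  intro z
  refine (hasDerivAt_integral_of_dominated_loc_of_deriv_le
    (F := fun z (ξ : ℝ) => Complex.exp (Complex.I * k * z * ξ) * φ ξ)
    (F' := fun z (ξ : ℝ) => Complex.exp (Complex.I * k * z * ξ) * (Complex.I * k * ξ) * φ ξ)
    -- The majorant holds on the unit ball around `z`, where `‖w‖ ≤ ‖z‖ + 1`; compact support of `φ`
    -- makes it integrable.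
    (bound := fun ξ : ℝ => Real.exp (|k| * (‖z‖ + 1) * |ξ|) * (|k| * |ξ|) * ‖φ ξ‖)
    (Metric.ball_mem_nhds z one_pos) (.of_forall fun w => ?_)
    (integrable_laplaceFourier k h1 h2 z) ?_ (.of_forall fun ξ w hw => ?_) ?_
    (.of_forall fun ξ w hw => ?_)).2.differentiableAt
  · exact (integrable_laplaceFourier k h1 h2 w).aestronglyMeasurable
  · have : Continuous fun ξ : ℝ =>
        Complex.exp (Complex.I * k * z * ξ) * (Complex.I * k * ξ) * φ ξ := by fun_prop
    exact this.aestronglyMeasurable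
  · rw [norm_mul, norm_mul, norm_mul, norm_mul, Complex.norm_I, one_mul, Complex.norm_real,
      Complex.norm_real, Real.norm_eq_abs, Real.norm_eq_abs]
    gcongr
    refine (Complex.norm_exp_le_exp_norm _).trans (Real.exp_le_exp.mpr ?_)
    rw [norm_mul, norm_mul, norm_mul, Complex.norm_I, one_mul, Complex.norm_real,
      Complex.norm_real, Real.norm_eq_abs, Real.norm_eq_abs]
    gcongr
    have := norm_add_le z (w - z)
    rw [add_sub_cancel] at this
    linarith [(mem_ball_iff_norm.mp hw).le]
  · refine Continuous.integrable_of_hasCompactSupport ?_ h2.norm.mul_left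
    fun_prop
  · have h := ((((hasDerivAt_id w).const_mul (Complex.I * k)).mul_const (ξ : ℂ)).cexp).mul_const
      (φ ξ)
    simpa using h

theorem laplaceFourier_deriv (k : ℝ) {φ : ℝ → ℂ} (h1 : ContDiff ℝ ∞ φ)
    (h2 : HasCompactSupport φ) (z : ℂ) :
    laplaceFourier k (deriv φ) z = -(Complex.I * k * z) * laplaceFourier k φ z := by
  have hds : ContDiff ℝ ∞ (deriv φ) := (contDiff_infty_iff_deriv.mp h1).2
  have hu : ∀ ξ : ℝ, HasDerivAt (fun ξ : ℝ => Complex.exp (Complex.I * k * z * ξ))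
      (Complex.exp (Complex.I * k * z * ξ) * (Complex.I * k * z)) ξ := fun ξ => by
    simpa using ((Complex.ofRealCLM.hasDerivAt (x := ξ)).const_mul (Complex.I * k * z)).cexp
  have hi := integrable_laplaceFourier k h1.continuous h2 z
  have h := integral_mul_deriv_eq_deriv_mul_of_integrable
    (u := fun ξ : ℝ => Complex.exp (Complex.I * k * z * ξ)) (v := φ) (v' := deriv φ)
    (fun ξ _ => hu ξ)
    (fun ξ _ => (h1.differentiable (by simp) ξ).hasDerivAt)
    (integrable_laplaceFourier k hds.continuous h2.deriv z) (by
      refine (hi.const_mul (Complex.I * k * z)).congr (.of_forall fun ξ => ?_)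
      simp only [Pi.mul_apply]
      ring) hi
  rw [laplaceFourier, h, laplaceFourier, ← integral_neg, ← integral_const_mul]
  congr 1
  ext ξ
  ring

/-- Each integration by parts gains a factor `|k| ‖z‖`, so the bound for `φ` and for `deriv φ` at
exponent `M` gives the one at `M + 1`. The restriction `|Im z| ≤ 1` keeps `|exp(i k z ξ)| ≤ exp(|k|
|ξ|)`. -/
theorem exists_norm_laplaceFourier_le {k : ℝ} (hk : k ≠ 0) {φ : ℝ → ℂ} (h1 : ContDiff ℝ ∞ φ)
    (h2 : HasCompactSupport φ) (M : ℕ) :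
    ∃ C : ℝ, 0 ≤ C ∧ ∀ z : ℂ, |z.im| ≤ 1 → (1 + ‖z‖) ^ M * ‖laplaceFourier k φ z‖ ≤ C := by
  induction M generalizing φ with
  | zero =>
    refine ⟨∫ ξ : ℝ, Real.exp (|k| * |ξ|) * ‖φ ξ‖, integral_nonneg fun ξ => by positivity,
      fun z hz => ?_⟩
    rw [pow_zero, one_mul]
    refine norm_integral_le_of_norm_le (Continuous.integrable_of_hasCompactSupport
      (by have := h1.continuous; fun_prop) h2.norm.mul_left) (.of_forall fun ξ => ?_)
    rw [norm_mul, Complex.norm_exp]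
    gcongr
    have e : (Complex.I * k * z * ξ).re = -(k * z.im * ξ) := by simp
    rw [e]
    refine (neg_le_abs _).trans ?_
    rw [abs_mul, abs_mul]
    gcongr
    exact mul_le_of_le_one_right (abs_nonneg k) hz
  | succ M ih =>
    obtain ⟨C, hC, hC'⟩ := ih h1 h2
    obtain ⟨D, hD, hD'⟩ := ih (contDiff_infty_iff_deriv.mp h1).2 h2.deriv
    refine ⟨C + |k|⁻¹ * D, by positivity, fun z hz => ?_⟩
    have e1 := hC' z hz
    have e2 := hD' z hz
    rw [laplaceFourier_deriv k h1 h2, norm_mul, norm_neg, norm_mul, norm_mul, Complex.norm_I,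
      one_mul, Complex.norm_real, Real.norm_eq_abs] at e2
    have hk' : 0 < |k| := abs_pos.mpr hk
    have e3 : |k|⁻¹ * ((1 + ‖z‖) ^ M * (|k| * ‖z‖ * ‖laplaceFourier k φ z‖)) ≤ |k|⁻¹ * D := by
      gcongr
    calc _ = (1 + ‖z‖) ^ M * ‖laplaceFourier k φ z‖ +
          |k|⁻¹ * ((1 + ‖z‖) ^ M * (|k| * ‖z‖ * ‖laplaceFourier k φ z‖)) := by
            field_simp
            ring
      _ ≤ _ := add_le_add e1 e3

/-! ### Moving the line of integration for functions of the class `𝒜` -/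

theorem StripClass.boundedBorel_top {f : ℂ → ℂ} (hf : StripClass f) :
    BoundedBorel (lineSlice f 0) :=
  ⟨hf.measurable_top, hf.bounded_top⟩

theorem StripClass.boundedBorel_bot {f : ℂ → ℂ} (hf : StripClass f) :
    BoundedBorel (lineSlice f (-1)) :=
  ⟨hf.measurable_bot, hf.bounded_bot⟩

theorem StripClass.exists_bound {f : ℂ → ℂ} (hf : StripClass f) {k l : ℝ} (hk : k ≠ 0)
    (hl : l ≠ 0) {φ ψ : ℝ → ℂ} (h1 : ContDiff ℝ ∞ φ) (h2 : HasCompactSupport φ)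
    (k1 : ContDiff ℝ ∞ ψ) (k2 : HasCompactSupport ψ) :
    ∃ C : ℝ, ∀ z : ℂ, -1 ≤ z.im → z.im ≤ 0 →
      ‖f z * (laplaceFourier k φ (z + Complex.I) * laplaceFourier l ψ (z + Complex.I))‖ ≤
        C * (1 + z.re ^ 2)⁻¹ := by
  obtain ⟨C, hC, N, hN⟩ := hf.poly_bounded
  -- `N` powers of decay absorb the growth of `f`, and two more give the integrable factor `(1 +
  -- x²)⁻¹`; boundedness of the other transform suffices.
  obtain ⟨D, hD, hD'⟩ := exists_norm_laplaceFourier_le hk h1 h2 (N + 2)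
  obtain ⟨D₀, hD₀, hD₀'⟩ := exists_norm_laplaceFourier_le hl k1 k2 0
  refine ⟨C * 2 ^ N * D * D₀, fun z hz1 hz2 => ?_⟩
  have him : |(z + Complex.I).im| ≤ 1 := by
    rw [abs_le, Complex.add_im, Complex.I_im]
    constructor <;> linarith
  have e1 := hN z hz1 hz2
  have e2 := hD' _ him
  have e3 := hD₀' _ him
  rw [pow_zero, one_mul] at e3
  set q := 1 + ‖z + Complex.I‖ with hq
  have hz : 1 + ‖z‖ ≤ 2 * q := by
    have := norm_sub_le (z + Complex.I) Complex.I
    rw [add_sub_cancel_right, Complex.norm_I] at this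
    have := norm_nonneg (z + Complex.I)
    linarith
  have hq0 : 0 < q := by positivity
  have hre : 1 + z.re ^ 2 ≤ q ^ 2 := by
    have h := Complex.abs_re_le_norm (z + Complex.I)
    rw [Complex.add_re, Complex.I_re, add_zero] at h
    have h' := sq_abs z.re
    have := abs_nonneg z.re
    nlinarith
  have e4 : ‖f z‖ ≤ C * (2 ^ N * q ^ N) := by
    rw [← mul_pow]
    exact e1.trans (by gcongr)
  rw [norm_mul, norm_mul, ← div_eq_mul_inv, le_div_iff₀ (by positivity)]
  calc _ ≤ C * (2 ^ N * q ^ N) * (‖laplaceFourier k φ (z + Complex.I)‖ * D₀) * q ^ 2 := by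
        gcongr
    _ = C * 2 ^ N * (q ^ (N + 2) * ‖laplaceFourier k φ (z + Complex.I)‖) * D₀ := by ring
    _ ≤ _ := by gcongr

/-- The strip `-1 ≤ Im z ≤ 0` shifted by `i` lies in `|Im z| ≤ 1`, where the transforms decay; on
the lower line the shift brings their arguments back to the real axis. -/
theorem StripClass.integral_eq {f : ℂ → ℂ} (hf : StripClass f) {k l : ℝ} (hk : k ≠ 0)
    (hl : l ≠ 0) {φ ψ : ℝ → ℂ} (h1 : ContDiff ℝ ∞ φ) (h2 : HasCompactSupport φ)
    (k1 : ContDiff ℝ ∞ ψ) (k2 : HasCompactSupport ψ) :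
    ∫ x : ℝ, lineSlice f 0 x *
        (laplaceFourier k φ (x + Complex.I) * laplaceFourier l ψ (x + Complex.I)) =
      ∫ x : ℝ, lineSlice f (-1) x * (laplaceFourier k φ x * laplaceFourier l ψ x) := by
  obtain ⟨C, hC⟩ := hf.exists_bound hk hl h1 h2 k1 k2
  have d1 := differentiable_laplaceFourier k h1.continuous h2
  have d2 := differentiable_laplaceFourier l k1.continuous k2
  have hsh : Differentiable ℂ fun z => laplaceFourier k φ (z + Complex.I) *
      laplaceFourier l ψ (z + Complex.I) :=
    (d1.comp (differentiable_id.add_const _)).mul (d2.comp (differentiable_id.add_const _))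
  have hline : ∀ x : ℝ, Continuous fun y : ℝ => (⟨x, y⟩ : ℂ) := fun x => by
    have : (fun y : ℝ => (⟨x, y⟩ : ℂ)) = fun y : ℝ => (x : ℂ) + y * Complex.I := by
      ext y
      apply Complex.ext <;> simp
    rw [this]
    fun_prop
  have hcont : ∀ (x c : ℝ) (s : Set ℝ), Tendsto (fun y : ℝ =>
      laplaceFourier k φ (⟨x, y⟩ + Complex.I) * laplaceFourier l ψ (⟨x, y⟩ + Complex.I))
      (𝓝[s] c) (𝓝 (laplaceFourier k φ (⟨x, c⟩ + Complex.I) *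
        laplaceFourier l ψ (⟨x, c⟩ + Complex.I))) := fun x c s =>
    ((hsh.continuous.comp (hline x)).tendsto c).mono_left nhdsWithin_le_nhds
  have h := integral_strip_boundary_eq (G := fun z => f z * (laplaceFourier k φ (z + Complex.I) *
    laplaceFourier l ψ (z + Complex.I))) (C := C)
    (hf.holomorphic.mul hsh.differentiableOn)
    (fun x y hy1 hy2 => hC ⟨x, y⟩ hy1.le hy2.le)
    (hf.tendsto_top.mono fun x hx => hx.mul (hcont x _ _))
    (hf.tendsto_bot.mono fun x hx => hx.mul (hcont x _ _))
  have e0 : ∀ x : ℝ, (⟨x, 0⟩ : ℂ) = x := fun x => rfl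
  have e1 : ∀ x : ℝ, (⟨x, -1⟩ : ℂ) + Complex.I = x := fun x => by
    apply Complex.ext <;> simp
  simpa only [lineSlice, e1, e0] using h

/-! ### Matrix elements of the functional calculus between test functions -/

theorem fourier_eq_laplaceFourier {K : ℝ} (hK : K ≠ 0) (φ : ℝ → ℂ) (t : ℝ) :
    FourierTransform.fourier φ t = laplaceFourier K φ (momentumSymbol K t) := by
  rw [Real.fourier_real_eq_integral_exp_smul, laplaceFourier]
  congr 1
  ext ξ
  have hK' : (K : ℂ) ≠ 0 := by exact_mod_cast hK
  rw [smul_eq_mul, momentumSymbol]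
  congr 2
  push_cast
  field_simp

/-- This is how `B^{1/2}` becomes a complex translation: `e^{-kξ}` combines with `e^{ikzξ}` to
`e^{ik(z+i)ξ}`. -/
theorem laplaceFourier_exp_mul (k : ℝ) (φ : ℝ → ℂ) (z : ℂ) :
    laplaceFourier k (fun ξ => (Real.exp (-(k * ξ)) : ℂ) * φ ξ) z =
      laplaceFourier k φ (z + Complex.I) := by
  rw [laplaceFourier, laplaceFourier]
  congr 1
  ext ξ
  rw [← mul_assoc, Complex.ofReal_exp, ← Complex.exp_add]
  congr 2
  push_cast
  linear_combination (-(k * ξ : ℂ)) * Complex.I_sq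

/-- Conjugation on the real axis changes `k` to `-k` and leaves an expression holomorphic in the
spectral variable. It also makes the weight `e^{Kξ}` in the left entry act as a shift by `+i`. -/
theorem conj_laplaceFourier (k : ℝ) (φ : ℝ → ℂ) (x : ℝ) :
    (starRingEnd ℂ) (laplaceFourier k φ x) =
      laplaceFourier (-k) (fun ξ => (starRingEnd ℂ) (φ ξ)) x := by
  rw [laplaceFourier, laplaceFourier, ← integral_conj]
  congr 1
  ext ξ
  rw [map_mul, ← Complex.exp_conj]
  simp

/-- The change of variables `s = -(2π/K) t` yields the constant, which is independent of `g` and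
cancels when two symbols are compared. -/
theorem inner_borelFunctionalCalculus {K : ℝ} (hK : 0 < K) {g : ℝ → ℂ} (hg : BoundedBorel g)
    {φ ψ : ℝ → ℂ} (h1 : ContDiff ℝ ∞ φ) (h2 : HasCompactSupport φ) (k1 : ContDiff ℝ ∞ ψ)
    (k2 : HasCompactSupport ψ) {x y : L2R} (hx : x =ᵐ[volume] φ) (hy : y =ᵐ[volume] ψ) :
    ⟪x, borelFunctionalCalculus (momentumBar K) g y⟫_ℂ =
      |(2 * Real.pi / K)⁻¹| • ∫ s : ℝ, g s *
        (laplaceFourier (-K) (fun ξ => (starRingEnd ℂ) (φ ξ)) s * laplaceFourier K ψ s) := by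
  rw [borelFunctionalCalculus_momentumBar hK hg, inner_fourierMul]
  have h := Measure.integral_comp_mul_left (fun s : ℝ => g s *
    (laplaceFourier (-K) (fun ξ => (starRingEnd ℂ) (φ ξ)) s * laplaceFourier K ψ s))
    (-(2 * Real.pi / K))
  rw [inv_neg, abs_neg] at h
  rw [← h]
  refine integral_congr_ae ?_
  filter_upwards [fourierL2_of_smooth h1 h2 hx, fourierL2_of_smooth k1 k2 hy] with t a1 a2
  rw [a1, a2, fourier_eq_laplaceFourier hK.ne', fourier_eq_laplaceFourier hK.ne',
    conj_laplaceFourier, neg_mul]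
  rfl

theorem contDiff_conj {φ : ℝ → ℂ} (h1 : ContDiff ℝ ∞ φ) :
    ContDiff ℝ ∞ fun ξ => (starRingEnd ℂ) (φ ξ) :=
  (Complex.conjCLE : ℂ →L[ℝ] ℂ).contDiff.comp h1

theorem contDiff_cexp_neg_mul (K : ℝ) : ContDiff ℝ ∞ fun ξ : ℝ => (Real.exp (-(K * ξ)) : ℂ) := by
  simpa only [neg_mul] using contDiff_cexp_mul (-K)

theorem StripClass.inner_eq {K : ℝ} (hK : 0 < K) {f : ℂ → ℂ} (hf : StripClass f)
    {φ ψ : ℝ → ℂ} (h1 : ContDiff ℝ ∞ φ) (h2 : HasCompactSupport φ) (k1 : ContDiff ℝ ∞ ψ)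
    (k2 : HasCompactSupport ψ) {x x' y y' : L2R} (hx : x =ᵐ[volume] φ) (hy : y =ᵐ[volume] ψ)
    (hx' : x' =ᵐ[volume] fun ξ => (Real.exp (K * ξ) : ℂ) * φ ξ)
    (hy' : y' =ᵐ[volume] fun ξ => (Real.exp (-(K * ξ)) : ℂ) * ψ ξ) :
    ⟪x', borelFunctionalCalculus (momentumBar K) (lineSlice f 0) y'⟫_ℂ =
      ⟪x, borelFunctionalCalculus (momentumBar K) (lineSlice f (-1)) y⟫_ℂ := by
  have hc2 : HasCompactSupport fun ξ => (starRingEnd ℂ) (φ ξ) :=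
    h2.comp_left (g := starRingEnd ℂ) (map_zero _)
  rw [inner_borelFunctionalCalculus hK hf.boundedBorel_bot h1 h2 k1 k2 hx hy,
    inner_borelFunctionalCalculus hK hf.boundedBorel_top
      ((contDiff_cexp_mul K).mul h1) h2.mul_left
      ((contDiff_cexp_neg_mul K).mul k1) k2.mul_left hx' hy',
    ← hf.integral_eq (neg_ne_zero.mpr hK.ne') hK.ne' (contDiff_conj h1) hc2 k1 k2]
  congr 2
  ext s
  rw [laplaceFourier_exp_mul, ← laplaceFourier_exp_mul (-K)]
  congr 3
  ext ξ
  rw [map_mul, Complex.conj_ofReal, neg_mul, neg_neg]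

/-! ### The conjugated operator -/

/-- The function `(1 + e^{-Kξ})⁻¹`. -/
noncomputable def logisticWeight (K ξ : ℝ) : ℂ := (1 + (Real.exp (-(K * ξ)) : ℂ))⁻¹

theorem one_add_exp_ne_zero (x : ℝ) : (1 + (Real.exp x : ℂ)) ≠ 0 := by
  have : (1 + Real.exp x : ℝ) ≠ 0 := by positivity
  exact_mod_cast this

theorem contDiff_logisticWeight (K : ℝ) : ContDiff ℝ ∞ (logisticWeight K) :=
  (contDiff_const.add (contDiff_cexp_neg_mul K)).inv fun _ => one_add_exp_ne_zero _

theorem norm_one_add_exp (x : ℝ) : ‖(1 + (Real.exp x : ℂ))‖ = 1 + Real.exp x := by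
  have : (1 + (Real.exp x : ℂ)) = ((1 + Real.exp x : ℝ) : ℂ) := by push_cast; rfl
  rw [this, Complex.norm_real, Real.norm_eq_abs, abs_of_pos (by positivity)]

theorem boundedBorel_logisticWeight (K : ℝ) : BoundedBorel (logisticWeight K) := by
  refine ⟨(contDiff_logisticWeight K).continuous.stronglyMeasurable, 1, fun ξ => ?_⟩
  rw [logisticWeight, norm_inv, norm_one_add_exp]
  exact inv_le_one_of_one_le₀ (by linarith [Real.exp_pos (-(K * ξ))])

theorem boundedBorel_exp_mul_logisticWeight (K : ℝ) :
    BoundedBorel fun ξ => (Real.exp (-(K * ξ)) : ℂ) * logisticWeight K ξ := by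
  refine ⟨((contDiff_cexp_neg_mul K).continuous.mul
    (contDiff_logisticWeight K).continuous).stronglyMeasurable, 1, fun ξ => ?_⟩
  simp only [logisticWeight]
  rw [norm_mul, norm_inv, norm_one_add_exp, Complex.norm_real, Real.norm_eq_abs,
    Real.abs_exp, ← div_eq_mul_inv]
  exact (div_le_one (by positivity)).mpr (by linarith)

/-- Both sides are continuous in `w`, and for a test function `w` the identity is
`StripClass.inner_eq` with `ψ = (1 + e^{-Kξ})⁻¹ w`. -/
theorem StripClass.inner_eq_weighted {K : ℝ} (hK : 0 < K) {f : ℂ → ℂ} (hf : StripClass f)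
    {φ : ℝ → ℂ} (h1 : ContDiff ℝ ∞ φ) (h2 : HasCompactSupport φ) {x x' : L2R}
    (hx : x =ᵐ[volume] φ) (hx' : x' =ᵐ[volume] fun ξ => (Real.exp (K * ξ) : ℂ) * φ ξ) (w : L2R) :
    ⟪x', borelFunctionalCalculus (momentumBar K) (lineSlice f 0)
        (boundedMul _ (boundedBorel_exp_mul_logisticWeight K) w)⟫_ℂ =
      ⟪x, borelFunctionalCalculus (momentumBar K) (lineSlice f (-1))
        (boundedMul _ (boundedBorel_logisticWeight K) w)⟫_ℂ := by
  have hd := Lp.dense_hasCompactSupport_contDiff (E := ℝ) (F := ℂ) (μ := volume) (p := 2)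
    (by simp)
  refine congrFun (Continuous.ext_on hd (f := fun w => ⟪x', borelFunctionalCalculus (momentumBar K)
    (lineSlice f 0) (boundedMul _ (boundedBorel_exp_mul_logisticWeight K) w)⟫_ℂ)
    (g := fun w => ⟪x, borelFunctionalCalculus (momentumBar K) (lineSlice f (-1))
      (boundedMul _ (boundedBorel_logisticWeight K) w)⟫_ℂ) (by fun_prop) (by fun_prop) ?_) w
  rintro w ⟨χ, hχ, hc, hs⟩
  refine hf.inner_eq hK h1 h2 (ψ := fun ξ => logisticWeight K ξ * χ ξ)
    ((contDiff_logisticWeight K).mul hs) hc.mul_left hx ?_ hx' ?_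
  · filter_upwards [coeFn_boundedMul (boundedBorel_logisticWeight K) w, hχ] with ξ a1 a2
    rw [a1, a2]
  · filter_upwards [coeFn_boundedMul (boundedBorel_exp_mul_logisticWeight K) w, hχ] with ξ a1 a2
    rw [a1, a2, mul_assoc]

theorem coeFn_mulOp {g : ℝ → ℂ} (u : (mulOp g).domain) :
    mulOp g u =ᵐ[volume] fun ξ => g ξ * (u : L2R) ξ :=
  MemLp.coeFn_toLp u.2

theorem coeFn_BHalf {K : ℝ} (u : (BHalf K).domain) :
    BHalf K u =ᵐ[volume] fun ξ => (Real.exp (-(K * ξ)) : ℂ) * (u : L2R) ξ :=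
  coeFn_mulOp u

theorem StripClass.inner_eq_domain {K : ℝ} (hK : 0 < K) {f : ℂ → ℂ} (hf : StripClass f)
    {φ : ℝ → ℂ} (h1 : ContDiff ℝ ∞ φ) (h2 : HasCompactSupport φ) {x x' : L2R}
    (hx : x =ᵐ[volume] φ) (hx' : x' =ᵐ[volume] fun ξ => (Real.exp (K * ξ) : ℂ) * φ ξ)
    (u : (BHalf K).domain) :
    ⟪x', borelFunctionalCalculus (momentumBar K) (lineSlice f 0) (BHalf K u)⟫_ℂ =
      ⟪x, borelFunctionalCalculus (momentumBar K) (lineSlice f (-1)) (u : L2R)⟫_ℂ := by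
  -- For `w = u + B^{1/2} u` the two bounded multipliers return exactly `u` and `B^{1/2} u`, so
  -- every `u` in the domain is reached without a separate approximation in the graph norm.
  have h := hf.inner_eq_weighted hK h1 h2 hx hx' ((u : L2R) + BHalf K u)
  have e1 : boundedMul _ (boundedBorel_logisticWeight K) ((u : L2R) + BHalf K u) = u := by
    refine Lp.ext ((coeFn_boundedMul _ _).trans ?_)
    filter_upwards [Lp.coeFn_add (u : L2R) (BHalf K u), coeFn_BHalf u] with ξ a1 a2
    rw [a1, Pi.add_apply, a2, logisticWeight]
    have := one_add_exp_ne_zero (-(K * ξ))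
    field_simp
  have e2 : boundedMul _ (boundedBorel_exp_mul_logisticWeight K) ((u : L2R) + BHalf K u) =
      BHalf K u := by
    refine Lp.ext ((coeFn_boundedMul _ _).trans ?_)
    filter_upwards [Lp.coeFn_add (u : L2R) (BHalf K u), coeFn_BHalf u] with ξ a1 a2
    rw [a1, Pi.add_apply, a2, logisticWeight]
    have := one_add_exp_ne_zero (-(K * ξ))
    field_simp
  rwa [e1, e2] at h

/-- The left side is not yet known to be in `L²`, only locally integrable. That is enough to compare
both sides through test functions. -/
theorem StripClass.ae_eq {K : ℝ} (hK : 0 < K) {f : ℂ → ℂ} (hf : StripClass f)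
    (u : (BHalf K).domain) :
    (fun ξ : ℝ => (Real.exp (K * ξ) : ℂ) *
      borelFunctionalCalculus (momentumBar K) (lineSlice f 0) (BHalf K u) ξ) =ᵐ[volume]
      borelFunctionalCalculus (momentumBar K) (lineSlice f (-1)) (u : L2R) := by
  have hloc : ∀ v : L2R, LocallyIntegrable v volume := fun v =>
    (Lp.memLp v).locallyIntegrable (by norm_num)
  have hE := (contDiff_cexp_mul K).continuous
  refine ae_eq_of_integral_contDiff_smul_eq
    (by simpa using (hloc _).continuous_smul hE) (hloc _) fun φ h1 h2 => ?_
  -- The variational lemma uses real test functions, so the conjugation in the inner product has no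
  -- effect.
  let φ' : ℝ → ℂ := fun ξ => (φ ξ : ℂ)
  have k1 : ContDiff ℝ ∞ φ' := Complex.ofRealCLM.contDiff.comp h1
  have k2 : HasCompactSupport φ' := h2.comp_left Complex.ofReal_zero
  have h := hf.inner_eq_domain hK k1 k2 (coeFn_smoothToL2 k1 k2)
    (coeFn_smoothToL2 ((contDiff_cexp_mul K).mul k1) k2.mul_left) u
  rw [L2.inner_def, L2.inner_def] at h
  refine (integral_congr_ae ?_).trans (h.trans (integral_congr_ae ?_))
  · filter_upwards [coeFn_smoothToL2 ((contDiff_cexp_mul K).mul k1) k2.mul_left] with ξ a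
    rw [a, RCLike.inner_apply]
    simp only [map_mul, Complex.conj_ofReal, φ', Complex.real_smul]
    ring
  · filter_upwards [coeFn_smoothToL2 k1 k2] with ξ a
    rw [a, RCLike.inner_apply]
    simp only [Complex.conj_ofReal, φ', Complex.real_smul]
    ring

/-- The outer domain condition is automatic: by `StripClass.ae_eq`, `e^{Kξ} f(p̄,0) B^{1/2} u`
agrees with an `L²` function. -/
theorem conjugatedOp_domain {K : ℝ} (hK : 0 < K) {f : ℂ → ℂ} (hf : StripClass f) :
    (conjugatedOp K (lineSlice f 0)).domain = (BHalf K).domain := by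
  ext u
  constructor
  · rintro ⟨⟨hu, -⟩, -⟩
    exact hu
  · intro hu
    refine ⟨⟨hu, Submodule.mem_top⟩, ?_⟩
    exact (Lp.memLp _).ae_eq (hf.ae_eq hK ⟨u, hu⟩).symm

theorem conjugatedOp_apply {K : ℝ} (hK : 0 < K) {f : ℂ → ℂ} (hf : StripClass f)
    (u : (conjugatedOp K (lineSlice f 0)).domain) :
    conjugatedOp K (lineSlice f 0) u =
      borelFunctionalCalculus (momentumBar K) (lineSlice f (-1)) (u : L2R) := by
  have hu : (u : L2R) ∈ (BHalf K).domain := u.2.1.1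
  exact Lp.ext ((coeFn_mulOp (g := fun ξ => (Real.exp (K * ξ) : ℂ)) ⟨_, u.2.2⟩).trans (hf.ae_eq hK ⟨u, hu⟩))

theorem smoothCompact_le_BHalf_domain (K : ℝ) : smoothCompact ≤ (BHalf K).domain := by
  rintro u ⟨φ, h1, h2, h3⟩
  refine (((contDiff_cexp_neg_mul K).continuous.mul
    h1.continuous).memLp_of_hasCompactSupport h2.mul_left).ae_eq ?_
  filter_upwards [h3] with ξ a
  rw [Pi.mul_apply, a]

theorem dense_smoothCompact : Dense (smoothCompact : Set L2R) :=
  (Lp.dense_hasCompactSupport_contDiff (E := ℝ) (F := ℂ) (μ := volume) (p := 2)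
    (by simp)).mono (by
      rintro u ⟨φ, h1, h2, h3⟩
      exact ⟨φ, h3, h2, h1⟩)

/-! ### Closure of a densely defined restriction of a bounded operator -/

theorem mem_graph_boundedOp {H : Type*} [NormedAddCommGroup H] [NormedSpace ℂ H] {S : H →L[ℂ] H}
    {w : H × H} : w ∈ (boundedOp S).graph ↔ S w.1 = w.2 := by
  rw [LinearPMap.mem_graph_iff]
  constructor
  · rintro ⟨y, h1, h2⟩
    rw [← h1, ← h2]
    rfl
  · intro h
    exact ⟨⟨w.1, Submodule.mem_top⟩, rfl, h⟩

/-- A densely defined restriction of a bounded operator has the latter as its closure. -/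
theorem topologicalClosure_graph_eq_boundedOp {H : Type*} [NormedAddCommGroup H]
    [NormedSpace ℂ H] {S : H →L[ℂ] H} {T : H →ₗ.[ℂ] H} (hT : Dense (T.domain : Set H))
    (h : ∀ x : T.domain, T x = S x) : T.graph.topologicalClosure = (boundedOp S).graph := by
  refine le_antisymm (Submodule.topologicalClosure_minimal _ ?_ ?_) fun w hw => ?_
  · intro w hw
    obtain ⟨y, h1, h2⟩ := (LinearPMap.mem_graph_iff _).mp hw
    rw [mem_graph_boundedOp, ← h1, ← h2, h]
  · have : ((boundedOp S).graph : Set (H × H)) = {w | S w.1 = w.2} := by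
      ext w
      exact mem_graph_boundedOp
    rw [this]
    exact isClosed_eq (by fun_prop) continuous_snd
  · rw [mem_graph_boundedOp] at hw
    -- The continuous map `x ↦ (x, S x)` carries the dense domain into the graph of `T`, hence every
    -- point of `H` into its closure.
    have hc : Continuous fun x : H => (x, S x) := by fun_prop
    have hm := map_mem_closure hc (hT w.1) (t := (T.graph : Set (H × H))) fun x hx => by
      rw [SetLike.mem_coe, LinearPMap.mem_graph_iff]
      exact ⟨⟨x, hx⟩, rfl, h _⟩
    rw [hw] at hm
    exact hm

theorem theorem2 (K : ℝ) (hK : 0 < K) :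
    (∃! E : ProjValuedMeasure L2R, E.IsSpectralMeasureOf (momentumBar K)) ∧
    ∀ f : ℂ → ℂ, StripClass f →
      smoothCompact ≤ (conjugatedOp K (lineSlice f 0)).domain ∧
      (conjugatedOp K (lineSlice f 0)).IsClosable ∧
      (conjugatedOp K (lineSlice f 0)).closure =
        boundedOp (borelFunctionalCalculus (momentumBar K) (lineSlice f (-1))) := by
  refine ⟨existsUnique_spectralMeasure_momentumBar hK, fun f hf => ?_⟩
  have hdom : smoothCompact ≤ (conjugatedOp K (lineSlice f 0)).domain := by
    rw [conjugatedOp_domain hK hf]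
    exact smoothCompact_le_BHalf_domain K
  have hcl := topologicalClosure_graph_eq_boundedOp (dense_smoothCompact.mono hdom)
    (conjugatedOp_apply hK hf)
  have hclosable : (conjugatedOp K (lineSlice f 0)).IsClosable := ⟨_, hcl⟩
  refine ⟨hdom, hclosable, LinearPMap.eq_of_eq_graph ?_⟩
  rw [← hclosable.graph_closure_eq_closure_graph, hcl]
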